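/- **Calculus.** Variables $x,y,z,\dots$ and prompts $p,q,\dots$ range over two countably infinite sets. Expressions, values and evaluation contexts are $$e ::= v \mid e\,e \mid \mathcal{P}x.e \mid \langle e\rangle_v \mid \mathcal{G}_v x.e \mid v \triangleleft e,\qquad v ::= x \mid \lambda x.e \mid p \mid \ulcorner E\urcorner,\qquad E ::= \square \mid E\,e \mid v\,E \mid \langle E\rangle_p ,$$ taken up to $\alpha$-conversion ($\mathcal P$: fresh-prompt generation, $\langle\cdot\rangle$: delimiter, $\mathcal G$: continuation grabbing, $\triangleleft$: throw). $\#(m)$ is the set of prompts occurring in $m$ and $\mathrm{sp}(E)$ the set of prompts $p$ with $E=E_1[\langle E_2\rangle_p]$ for some $E_1,E_2$. Reduction of closed expressions: $(\lambda x.e)\,v\to e\{v/x\}$; $\langle v\rangle_p\to v$; $\langle E[\mathcal G_p x.e]\rangle_p\to e\{\ulcorner E\urcorner/x\}$ if $p\notin \mathrm{sp}(E)$; $\ulcorner E\urcorner\triangleleft e\to E[e]$; $\mathcal P x.e\to e\{p/x\}$ if $p\notin\#(e)$; and $E[e_1]\to E[e_2]$ if $e_1\to e_2$ and $(\#(e_2)\setminus\#(e_1))\cap\#(E)=\varnothing$.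 Write $e\rightharpoonup e'$ if $e\to e'$, or if $e$ is a normal form and $e'=e$. **Multi-hole contexts** (promptless; used in closed form): $$C ::= V \mid C\,C \mid \mathcal P x.C \mid \langle C\rangle_V \mid \mathcal G_V x.C \mid V\triangleleft C \mid \star_i[C],\quad V ::= x\mid \lambda x.C\mid \ulcorner F\urcorner\mid \square_i,\quad F ::= \square\mid F\,C\mid V\,F\mid \langle F\rangle_{\square_i}\mid \star_i[F].$$ Filling with a finite sequence $\Gamma$ of closed values replaces $\square_i$ by $\Gamma_i$ and $\star_i[C]$ by $E[C[\Gamma]]$ where $\Gamma_i=\ulcorner E\urcorner$ (likewise for $F$). It is defined if all indices are in range, every $\star_i$ meets a continuation and every $\langle F\rangle_{\square_i}$ a prompt. **States and transitions.** A state is $(\Gamma,e)$ with $\Gamma$ a finite sequence of closed values and $e$ a closed expression, or just $\Gamma$; if $e$ is a value, $(\Gamma,e)$ is identified with the sequence $\Gamma$ extended by $e$. The transitions are: * $(\Gamma,e_1)\xrightarrow{\tau}(\Gamma,e_2)$ if $e_1\to e_2$ and $(\#(e_2)\setminus\#(e_1))\cap\#(\Gamma)=\varnothing$; * $\Gamma\xrightarrow{\lambda,i,V}(\Gamma,e\{V[\Gamma]/x\})$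 if $\Gamma_i=\lambda x.e$; * $\Gamma\xrightarrow{\mathrm{val}}\Gamma$; * $\Gamma\xrightarrow{\ulcorner\urcorner,i,V}(\Gamma,E[V[\Gamma]])$ if $\Gamma_i=\ulcorner E\urcorner$; * $\Gamma\xrightarrow{\ulcorner\urcorner,i,j}(\Gamma,\ulcorner E_1\urcorner,\ulcorner E_2\urcorner)$ if $\Gamma_i=\ulcorner E_1[\langle E_2\rangle_p]\urcorner$, $\Gamma_j=p$ and $p\notin \mathrm{sp}(E_2)$; * $\Gamma\xrightarrow{\#,i,j}\Gamma$ if $\Gamma_i=\Gamma_j$ is a prompt; * $\Gamma\xrightarrow{\#}(\Gamma,p)$ if $p\notin\#(\Gamma)$; * $(\Gamma,E[\mathcal G_p x.e])\xrightarrow{F}(\Gamma,e')$ if $p\notin \mathrm{sp}(E)$ and $F[\Gamma][E[\mathcal G_p x.e]]\rightharpoonup e'$. The weak transition $\stackrel{\alpha}{\Rightarrow}$ is $\xrightarrow{\tau}{}^{*}$ if $\alpha=\tau$, and $\xrightarrow{\tau}{}^{*}\xrightarrow{\alpha}\xrightarrow{\tau}{}^{*}$ otherwise. The transitions $\xrightarrow{\mathrm{val}}$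 and $\xrightarrow{\ulcorner\urcorner,i,V}$ are called passive, the others active. A relation $R$ diacritically progresses to $S,T$ if $R\subseteq S$, $R\subseteq T$, and whenever $s\mathrel R t$: for each passive (respectively active) $s\xrightarrow{\alpha}s'$ there is $t'$ with $t\stackrel{\alpha}{\Rightarrow}t'$ and $s'\mathrel S t'$ (respectively $s'\mathrel T t'$), and conversely for the transitions of $t$. A $\star$-bisimulation is an $R$ that diacritically progresses to $R,R$; $\star$-bisimilarity is the union of all $\star$-bisimulations. **Handlers.** With $\mathsf{let}$, sequencing, booleans, $\mathsf{if}$ and $\mathsf{fix}$ encoded as usual in the call-by-value $\lambda$-calculus, and $$e_1 = e_2 \;:=\; \mathsf{let}\,x=e_1\,\mathsf{in}\,\mathsf{let}\,y=e_2\,\mathsf{in}\,\langle \langle \mathcal G_x\_.\mathsf{false}\rangle_y;\mathsf{true}\rangle_x ,$$ let $$\mathsf{handle}:=\lambda f.\lambda h.\mathcal P x.\langle f\,(\lambda z.\mathcal G_x\_.\,h\,z)\rangle_x,$$ $$\mathsf{handle}_p:=\lambda f.\lambda h.\mathcal P x.\,\langle \mathsf{let}\,r=f\,\mathsf{raise}_{p,x}\,\mathsf{in}\,\lambda\_.\lambda\_.r\rangle_p\;x\;h,$$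 $$\mathsf{raise}_{p,x}:=\mathsf{fix}\,r\,z.\,\mathcal G_p\_.\,\lambda y.\lambda h.\,\mathsf{if}\;x=y\;\mathsf{then}\;h\,z\;\mathsf{else}\;r\,z .$$ **Claim.** For every prompt $p$, the states $(\varnothing,\mathsf{handle})$ and $(\varnothing,\mathsf{handle}_p)$ are $\star$-bisimilar. -/

import Mathlib

namespace DelimControl

/-- Prompts: a countably infinite set of names. -/
abbrev Prompt : Type := ℕ

/-! ## The calculus

Terms are considered up to renaming of bound variables, represented by de Bruijn indices:
`Expr n`, `Val n` and `ECtx n` are the expressions, values and evaluation contexts whose free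
variables are among `n` given ones (index `0` is the innermost), so `n = 0` means closed. -/

mutual

/-- Expressions. -/
inductive Expr : ℕ → Type
  /-- a value -/
  | val {n : ℕ} (v : Val n) : Expr n
  /-- application -/
  | app {n : ℕ} (e₁ e₂ : Expr n) : Expr n
  /-- prompt generation, binding the generated prompt -/
  | fresh {n : ℕ} (e : Expr (n + 1)) : Expr n
  /-- the control delimiter -/
  | reset {n : ℕ} (v : Val n) (e : Expr n) : Expr n
  /-- the continuation-grabbing construct, binding the captured context -/
  | grab {n : ℕ} (v : Val n) (e : Expr (n + 1)) : Expr n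
  /-- throwing an expression to a captured context -/
  | throw {n : ℕ} (v : Val n) (e : Expr n) : Expr n

/-- Values. -/
inductive Val : ℕ → Type
  | var {n : ℕ} (i : Fin n) : Val n
  | lam {n : ℕ} (e : Expr (n + 1)) : Val n
  | prompt {n : ℕ} (p : Prompt) : Val n
  /-- a captured evaluation context -/
  | cont {n : ℕ} (E : ECtx n) : Val n

/-- Evaluation contexts, read outside-in. -/
inductive ECtx : ℕ → Type
  | hole {n : ℕ} : ECtx n
  | appL {n : ℕ} (E : ECtx n) (e : Expr n) : ECtx n
  | appR {n : ℕ} (v : Val n) (E : ECtx n) : ECtx n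
  | reset {n : ℕ} (p : Prompt) (E : ECtx n) : ECtx n

end

/-- Extension of a renaming under a binder. -/
def liftRen {n m : ℕ} (ρ : Fin n → Fin m) : Fin (n + 1) → Fin (m + 1) :=
  Fin.cases 0 (fun i => (ρ i).succ)

mutual

/-- Renaming of free variables. -/
def Expr.rename : {n m : ℕ} → (Fin n → Fin m) → Expr n → Expr m
  | _, _, ρ, .val v => .val (v.rename ρ)
  | _, _, ρ, .app e₁ e₂ => .app (e₁.rename ρ) (e₂.rename ρ)
  | _, _, ρ, .fresh e => .fresh (e.rename (liftRen ρ))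
  | _, _, ρ, .reset v e => .reset (v.rename ρ) (e.rename ρ)
  | _, _, ρ, .grab v e => .grab (v.rename ρ) (e.rename (liftRen ρ))
  | _, _, ρ, .throw v e => .throw (v.rename ρ) (e.rename ρ)

/-- Renaming of free variables. -/
def Val.rename : {n m : ℕ} → (Fin n → Fin m) → Val n → Val m
  | _, _, ρ, .var i => .var (ρ i)
  | _, _, ρ, .lam e => .lam (e.rename (liftRen ρ))
  | _, _, _, .prompt p => .prompt p
  | _, _, ρ, .cont E => .cont (E.rename ρ)

/-- Renaming of free variables. -/
def ECtx.rename : {n m : ℕ} → (Fin n → Fin m) → ECtx n → ECtx m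
  | _, _, _, .hole => .hole
  | _, _, ρ, .appL E e => .appL (E.rename ρ) (e.rename ρ)
  | _, _, ρ, .appR v E => .appR (v.rename ρ) (E.rename ρ)
  | _, _, ρ, .reset p E => .reset p (E.rename ρ)

end

/-- Extension of a substitution under a binder. -/
def liftSub {n m : ℕ} (σ : Fin n → Val m) : Fin (n + 1) → Val (m + 1) :=
  Fin.cases (.var 0) (fun i => (σ i).rename Fin.succ)

mutual

/-- Simultaneous capture-avoiding substitution of values for the free variables. -/
def Expr.subst : {n m : ℕ} → (Fin n → Val m) → Expr n → Expr m
  | _, _, σ, .val v => .val (v.subst σ)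
  | _, _, σ, .app e₁ e₂ => .app (e₁.subst σ) (e₂.subst σ)
  | _, _, σ, .fresh e => .fresh (e.subst (liftSub σ))
  | _, _, σ, .reset v e => .reset (v.subst σ) (e.subst σ)
  | _, _, σ, .grab v e => .grab (v.subst σ) (e.subst (liftSub σ))
  | _, _, σ, .throw v e => .throw (v.subst σ) (e.subst σ)

/-- Simultaneous capture-avoiding substitution of values for the free variables. -/
def Val.subst : {n m : ℕ} → (Fin n → Val m) → Val n → Val m
  | _, _, σ, .var i => σ i
  | _, _, σ, .lam e => .lam (e.subst (liftSub σ))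
  | _, _, _, .prompt p => .prompt p
  | _, _, σ, .cont E => .cont (E.subst σ)

/-- Simultaneous capture-avoiding substitution of values for the free variables. -/
def ECtx.subst : {n m : ℕ} → (Fin n → Val m) → ECtx n → ECtx m
  | _, _, _, .hole => .hole
  | _, _, σ, .appL E e => .appL (E.subst σ) (e.subst σ)
  | _, _, σ, .appR v E => .appR (v.subst σ) (E.subst σ)
  | _, _, σ, .reset p E => .reset p (E.subst σ)

end

/-- `e.inst v` is `e` with `v` substituted for the variable of index `0`. -/
def Expr.inst {n : ℕ} (e : Expr (n + 1)) (v : Val n) : Expr n :=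
  e.subst (Fin.cases v Val.var)

mutual

/-- The prompts that occur in an expression. -/
def Expr.prompts : {n : ℕ} → Expr n → Finset Prompt
  | _, .val v => v.prompts
  | _, .app e₁ e₂ => e₁.prompts ∪ e₂.prompts
  | _, .fresh e => e.prompts
  | _, .reset v e => v.prompts ∪ e.prompts
  | _, .grab v e => v.prompts ∪ e.prompts
  | _, .throw v e => v.prompts ∪ e.prompts

/-- The prompts that occur in a value. -/
def Val.prompts : {n : ℕ} → Val n → Finset Prompt
  | _, .var _ => ∅
  | _, .lam e => e.prompts
  | _, .prompt p => {p}
  | _, .cont E => E.prompts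

/-- The prompts that occur in an evaluation context. -/
def ECtx.prompts : {n : ℕ} → ECtx n → Finset Prompt
  | _, .hole => ∅
  | _, .appL E e => E.prompts ∪ e.prompts
  | _, .appR v E => v.prompts ∪ E.prompts
  | _, .reset p E => {p} ∪ E.prompts

end

/-- `E.plug e` is `E[e]`. -/
def ECtx.plug {n : ℕ} : ECtx n → Expr n → Expr n
  | .hole, e => e
  | .appL E e', e => .app (E.plug e) e'
  | .appR v E, e => .app (.val v) (E.plug e)
  | .reset p E, e => .reset (.prompt p) (E.plug e)

/-- `E.comp E'` is `E[E']`. -/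
def ECtx.comp {n : ℕ} : ECtx n → ECtx n → ECtx n
  | .hole, E' => E'
  | .appL E e, E' => .appL (E.comp E') e
  | .appR v E, E' => .appR v (E.comp E')
  | .reset p E, E' => .reset p (E.comp E')

/-- The prompts that surround the hole of an evaluation context. -/
def ECtx.surrounding {n : ℕ} (E : ECtx n) : Set Prompt :=
  {p | ∃ E₁ E₂ : ECtx n, E = E₁.comp (.reset p E₂)}

/-- One-step reduction of closed expressions. -/
inductive Red : Expr 0 → Expr 0 → Prop
  | beta (e : Expr 1) (v : Val 0) : Red (.app (.val (.lam e)) (.val v)) (e.inst v)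
  | resetVal (p : Prompt) (v : Val 0) : Red (.reset (.prompt p) (.val v)) (.val v)
  | capture (p : Prompt) (E : ECtx 0) (e : Expr 1) (hp : p ∉ E.surrounding) :
      Red (.reset (.prompt p) (E.plug (.grab (.prompt p) e))) (e.inst (.cont E))
  | throw (E : ECtx 0) (e : Expr 0) : Red (.throw (.cont E) e) (E.plug e)
  | fresh (p : Prompt) (e : Expr 1) (hp : p ∉ e.prompts) : Red (.fresh e) (e.inst (.prompt p))
  | compat (E : ECtx 0) (e₁ e₂ : Expr 0) (h : Red e₁ e₂)
      (hfresh : (e₂.prompts \ e₁.prompts) ∩ E.prompts = ∅) : Red (E.plug e₁) (E.plug e₂)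

/-- A normal form reduces to itself, any other expression makes one reduction step. -/
def RedOrNormal (e e' : Expr 0) : Prop :=
  Red e e' ∨ ((∀ e'', ¬ Red e e'') ∧ e' = e)

/-! ## Multi-hole contexts

They contain no prompts. A hole `hole i` is to be filled with the `i`-th value of a sequence,
and `star i` only with a continuation, which is then plugged with what follows. Positions in
sequences are counted from `0`. -/

mutual

/-- Multi-hole contexts. -/
inductive MCtx : ℕ → Type
  | val {n : ℕ} (V : MVal n) : MCtx n
  | app {n : ℕ} (M₁ M₂ : MCtx n) : MCtx n
  | fresh {n : ℕ} (M : MCtx (n + 1)) : MCtx n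
  | reset {n : ℕ} (V : MVal n) (M : MCtx n) : MCtx n
  | grab {n : ℕ} (V : MVal n) (M : MCtx (n + 1)) : MCtx n
  | throw {n : ℕ} (V : MVal n) (M : MCtx n) : MCtx n
  | star {n : ℕ} (i : ℕ) (M : MCtx n) : MCtx n

/-- Multi-hole value contexts. -/
inductive MVal : ℕ → Type
  | var {n : ℕ} (i : Fin n) : MVal n
  | lam {n : ℕ} (M : MCtx (n + 1)) : MVal n
  | cont {n : ℕ} (F : MECtx n) : MVal n
  | hole {n : ℕ} (i : ℕ) : MVal n

/-- Multi-hole evaluation contexts; `evalHole` is the hole in evaluation position. -/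
inductive MECtx : ℕ → Type
  | evalHole {n : ℕ} : MECtx n
  | appL {n : ℕ} (F : MECtx n) (M : MCtx n) : MECtx n
  | appR {n : ℕ} (V : MVal n) (F : MECtx n) : MECtx n
  | reset {n : ℕ} (i : ℕ) (F : MECtx n) : MECtx n
  | star {n : ℕ} (i : ℕ) (F : MECtx n) : MECtx n

end

/-- The continuation in a value, if it is one. -/
def Val.toCont? {n : ℕ} : Val n → Option (ECtx n)
  | .cont E => some E
  | _ => none

/-- The prompt in a value, if it is one. -/
def Val.toPrompt? {n : ℕ} : Val n → Option Prompt
  | .prompt p => some p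
  | _ => none

mutual

/-- Filling the holes of a multi-hole context with closed values; undefined (`none`) if an index
is out of range, or if some `star i` is to be filled with a value that is not a continuation or
a delimiter in an evaluation context with a value that is not a prompt. -/
def MCtx.fill (Γ : List (Val 0)) : {n : ℕ} → MCtx n → Option (Expr n)
  | _, .val V => do
      let v ← V.fill Γ
      return .val v
  | _, .app M₁ M₂ => do
      let e₁ ← M₁.fill Γ
      let e₂ ← M₂.fill Γ
      return .app e₁ e₂
  | _, .fresh M => do
      let e ← M.fill Γ
      return .fresh e
  | _, .reset V M => do
      let v ← V.fill Γ
      let e ← M.fill Γ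
      return .reset v e
  | _, .grab V M => do
      let v ← V.fill Γ
      let e ← M.fill Γ
      return .grab v e
  | _, .throw V M => do
      let v ← V.fill Γ
      let e ← M.fill Γ
      return .throw v e
  | _, .star i M => do
      let w ← Γ[i]?
      let E ← w.toCont?
      let e ← M.fill Γ
      return (E.rename Fin.elim0).plug e

/-- Filling the holes of a multi-hole value context with closed values. -/
def MVal.fill (Γ : List (Val 0)) : {n : ℕ} → MVal n → Option (Val n)
  | _, .var i => some (.var i)
  | _, .lam M => do
      let e ← M.fill Γ
      return .lam e
  | _, .cont F => do
      let E ← F.fill Γ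
      return .cont E
  | _, .hole i => do
      let w ← Γ[i]?
      return w.rename Fin.elim0

/-- Filling the indexed holes of a multi-hole evaluation context with closed values. -/
def MECtx.fill (Γ : List (Val 0)) : {n : ℕ} → MECtx n → Option (ECtx n)
  | _, .evalHole => some .hole
  | _, .appL F M => do
      let E ← F.fill Γ
      let e ← M.fill Γ
      return .appL E e
  | _, .appR V F => do
      let v ← V.fill Γ
      let E ← F.fill Γ
      return .appR v E
  | _, .reset i F => do
      let w ← Γ[i]?
      let p ← w.toPrompt?
      let E ← F.fill Γ
      return .reset p E
  | _, .star i F => do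
      let w ← Γ[i]?
      let E' ← w.toCont?
      let E ← F.fill Γ
      return (E'.rename Fin.elim0).comp E

end

/-! ## The labelled transition system and ⋆-bisimilarity -/

/-- The prompts that occur in a sequence of values. -/
def envPrompts (Γ : List (Val 0)) : Finset Prompt :=
  (Γ.map Val.prompts).foldr (· ∪ ·) ∅

/-- An expression is a value. -/
def Expr.IsValue {n : ℕ} (e : Expr n) : Prop := ∃ v, e = .val v

/-- States `(Γ, e)`, where `Γ` is a finite sequence of closed values and `e` a closed expression;
if `e` is a value, then `(Γ, e)` is just a sequence of values, with `e` as its last element. -/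
inductive State : Type
  /-- a sequence of values -/
  | vals (Γ : List (Val 0)) : State
  /-- a sequence of values followed by an expression that is not a value -/
  | run (Γ : List (Val 0)) (e : Expr 0) (he : ¬ e.IsValue) : State

/-- The state `(Γ, e)`, for any closed expression `e`. -/
def State.of (Γ : List (Val 0)) : Expr 0 → State
  | .val v => .vals (Γ ++ [v])
  | .app e₁ e₂ => .run Γ (.app e₁ e₂) (fun ⟨_, h⟩ => nomatch h)
  | .fresh e => .run Γ (.fresh e) (fun ⟨_, h⟩ => nomatch h)
  | .reset v e => .run Γ (.reset v e) (fun ⟨_, h⟩ => nomatch h)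
  | .grab v e => .run Γ (.grab v e) (fun ⟨_, h⟩ => nomatch h)
  | .throw v e => .run Γ (.throw v e) (fun ⟨_, h⟩ => nomatch h)

/-- Labels of the transitions. -/
inductive Label : Type
  | tau
  /-- testing the `i`-th value, a λ-abstraction, with an argument -/
  | lam (i : ℕ) (V : MVal 0)
  /-- being a sequence of values -/
  | val
  /-- testing the `i`-th value, a continuation, with a value -/
  | ctx (i : ℕ) (V : MVal 0)
  /-- equality of the prompts at positions `i` and `j` -/
  | eqPrompt (i j : ℕ)
  /-- generation of a new prompt by the observer -/
  | newPrompt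
  /-- testing a control-stuck expression with an evaluation context -/
  | stuck (F : MECtx 0)
  /-- decomposition of the continuation at position `i` at the prompt at position `j` -/
  | decomp (i j : ℕ)

/-- The passive labels; all others are active. -/
def Label.Passive : Label → Prop
  | .val => True
  | .ctx _ _ => True
  | _ => False

/-- The labelled transition system. -/
inductive Step : State → Label → State → Prop
  | tau (Γ : List (Val 0)) (e₁ e₂ : Expr 0) (he : ¬ e₁.IsValue) (h : Red e₁ e₂)
      (hfresh : (e₂.prompts \ e₁.prompts) ∩ envPrompts Γ = ∅) :
      Step (.run Γ e₁ he) .tau (.of Γ e₂)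
  | lam (Γ : List (Val 0)) (i : ℕ) (e : Expr 1) (V : MVal 0) (v : Val 0)
      (hi : Γ[i]? = some (.lam e)) (hV : V.fill Γ = some v) :
      Step (.vals Γ) (.lam i V) (.of Γ (e.inst v))
  | val (Γ : List (Val 0)) : Step (.vals Γ) .val (.vals Γ)
  | ctx (Γ : List (Val 0)) (i : ℕ) (E : ECtx 0) (V : MVal 0) (v : Val 0)
      (hi : Γ[i]? = some (.cont E)) (hV : V.fill Γ = some v) :
      Step (.vals Γ) (.ctx i V) (.of Γ (E.plug (.val v)))
  | eqPrompt (Γ : List (Val 0)) (i j : ℕ) (p : Prompt)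
      (hi : Γ[i]? = some (.prompt p)) (hj : Γ[j]? = some (.prompt p)) :
      Step (.vals Γ) (.eqPrompt i j) (.vals Γ)
  | newPrompt (Γ : List (Val 0)) (p : Prompt) (hp : p ∉ envPrompts Γ) :
      Step (.vals Γ) .newPrompt (.vals (Γ ++ [.prompt p]))
  | stuck (Γ : List (Val 0)) (E : ECtx 0) (p : Prompt) (e : Expr 1)
      (he : ¬ (E.plug (.grab (.prompt p) e)).IsValue) (hp : p ∉ E.surrounding)
      (F : MECtx 0) (E' : ECtx 0) (hF : F.fill Γ = some E') (e' : Expr 0)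
      (h : RedOrNormal (E'.plug (E.plug (.grab (.prompt p) e))) e') :
      Step (.run Γ (E.plug (.grab (.prompt p) e)) he) (.stuck F) (.of Γ e')
  | decomp (Γ : List (Val 0)) (i j : ℕ) (E₁ E₂ : ECtx 0) (p : Prompt)
      (hi : Γ[i]? = some (.cont (E₁.comp (.reset p E₂)))) (hj : Γ[j]? = some (.prompt p))
      (hp : p ∉ E₂.surrounding) :
      Step (.vals Γ) (.decomp i j) (.vals (Γ ++ [.cont E₁, .cont E₂]))

/-- Reflexive and transitive closure of the `tau` transitions. -/
def WeakTau : State → State → Prop :=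
  Relation.ReflTransGen (fun s t => Step s .tau t)

/-- Weak transitions. -/
def WeakStep (s : State) (a : Label) (t : State) : Prop :=
  (a = .tau ∧ WeakTau s t) ∨
    (a ≠ .tau ∧ ∃ s' t', WeakTau s s' ∧ Step s' a t' ∧ WeakTau t' t)

/-- Diacritical progress of `R` to `S` (after passive transitions) and `T` (after active ones). -/
def Progress (R S T : State → State → Prop) : Prop :=
  (∀ s t, R s t → S s t) ∧ (∀ s t, R s t → T s t) ∧
  ∀ s t, R s t →
    (∀ a s', Step s a s' →
      (a.Passive → ∃ t', WeakStep t a t' ∧ S s' t') ∧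
      (¬ a.Passive → ∃ t', WeakStep t a t' ∧ T s' t')) ∧
    (∀ a t', Step t a t' →
      (a.Passive → ∃ s', WeakStep s a s' ∧ S s' t') ∧
      (¬ a.Passive → ∃ s', WeakStep s a s' ∧ T s' t'))

/-- ⋆-bisimulations. -/
def StarBisimulation (R : State → State → Prop) : Prop := Progress R R R

/-- ⋆-bisimilarity, the union of all ⋆-bisimulations. -/
def StarBisimilar (s t : State) : Prop :=
  ∃ R : State → State → Prop, StarBisimulation R ∧ R s t

/-! ## Call-by-value encodings -/

/-- The value of the variable of index `i`. -/
def vr {n : ℕ} (i : ℕ) (h : i < n := by omega) : Val n := .var ⟨i, h⟩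

/-- The expression consisting of the variable of index `i`. -/
def ev {n : ℕ} (i : ℕ) (h : i < n := by omega) : Expr n := .val (vr i h)

/-- Weakening of a value by one variable. -/
def Val.up {n : ℕ} (v : Val n) : Val (n + 1) := v.rename Fin.succ

/-- Weakening of an expression by one variable. -/
def Expr.up {n : ℕ} (e : Expr n) : Expr (n + 1) := e.rename Fin.succ

/-- `let x = e₁ in e₂`, that is, `(λ x. e₂) e₁`. -/
def letIn {n : ℕ} (e₁ : Expr n) (e₂ : Expr (n + 1)) : Expr n := .app (.val (.lam e₂)) e₁

/-- `e₁; e₂`, that is, `(λ _. e₂) e₁`. -/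
def seqE {n : ℕ} (e₁ e₂ : Expr n) : Expr n := letIn e₁ e₂.up

/-- `true`, that is, `λ a. λ b. a`. -/
def trueV {n : ℕ} : Val n := .lam (.val (.lam (ev 1)))

/-- `false`, that is, `λ a. λ b. b`. -/
def falseV {n : ℕ} : Val n := .lam (.val (.lam (ev 0)))

/-- `if e then e₁ else e₂`, that is, `e (λ _. e₁) (λ _. e₂) (λ a. a)`. -/
def ifE {n : ℕ} (e e₁ e₂ : Expr n) : Expr n :=
  .app (.app (.app e (.val (.lam e₁.up))) (.val (.lam e₂.up))) (.val (.lam (ev 0)))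

/-- `λ y. (λ r. λ z. e) (λ z. y y z)`; in `e`, the variable `r` has index `1` and `z` index `0`. -/
def fixAux {n : ℕ} (e : Expr (n + 2)) : Val n :=
  .lam (.app (.val (Val.lam (.val (.lam e))).up)
    (.val (.lam (.app (.app (ev 1) (ev 1)) (ev 0)))))

/-- The recursive function `fix r z. e`, by the call-by-value fixed-point combinator:
`λ z. w w z` where `w = λ y. (λ r. λ z. e) (λ z. y y z)`. -/
def fixV {n : ℕ} (e : Expr (n + 2)) : Val n :=
  .lam (.app (.app (.val (fixAux e).up) (.val (fixAux e).up)) (ev 0))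

/-- Equality test of prompts:
`let x = e₁ in let y = e₂ in reset x ((reset y (grab x _. false)); true)`. -/
def eqE {n : ℕ} (e₁ e₂ : Expr n) : Expr n :=
  letIn e₁ (letIn e₂.up
    (.reset (vr 1) (seqE (.reset (vr 0) (.grab (vr 1) (.val falseV))) (.val trueV))))

/-! ## Exception handlers -/

/-- `λ f. λ h. fresh x. reset x (f (λ z. grab x _. h z))`. -/
def handle : Val 0 :=
  .lam (.val (.lam (.fresh (.reset (vr 0)
    (.app (ev 2) (.val (.lam (.grab (vr 1) (.app (ev 3) (ev 1))))))))))

/-- `fix r z. grab p _. λ y. λ h. if x = y then h z else r z`. -/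
def raise {n : ℕ} (p : Prompt) (x : Val n) : Val n :=
  fixV (.grab (.prompt p) (.val (.lam (.val (.lam
    (ifE (eqE (.val x.up.up.up.up.up) (ev 1)) (.app (ev 0) (ev 3)) (.app (ev 4) (ev 3))))))))

/-- `λ f. λ h. fresh x. (reset p (let r = f raise_{p,x} in λ _. λ _. r)) x h`. -/
def handleP (p : Prompt) : Val 0 :=
  .lam (.val (.lam (.fresh
    (.app (.app
      (.reset (.prompt p)
        (letIn (.app (ev 2) (.val (raise p (vr 0)))) (.val (.lam (.val (.lam (ev 2)))))))
      (ev 0)) (ev 1)))))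

end DelimControl

namespace DelimControl

/-! ## Renaming and substitution -/

theorem liftRen_id {n : ℕ} : liftRen (id : Fin n → Fin n) = id := by
  funext i; cases i using Fin.cases <;> rfl

theorem liftRen_comp {n m k : ℕ} (ρ : Fin n → Fin m) (ρ' : Fin m → Fin k) :
    (fun i => liftRen ρ' (liftRen ρ i)) = liftRen (fun i => ρ' (ρ i)) := by
  funext i; cases i using Fin.cases <;> rfl

theorem liftSub_liftRen {n m k : ℕ} (ρ : Fin n → Fin m) (σ : Fin m → Val k) :
    (fun i => liftSub σ (liftRen ρ i)) = liftSub (fun i => σ (ρ i)) := by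
  funext i; cases i using Fin.cases <;> rfl

theorem liftSub_var {n m : ℕ} (ρ : Fin n → Fin m) :
    liftSub (fun i => Val.var (ρ i)) = fun i => Val.var (liftRen ρ i) := by
  funext i; cases i using Fin.cases <;> simp [liftSub, liftRen, Val.rename]

mutual

theorem Expr.rename_id : ∀ {n : ℕ} (e : Expr n), e.rename id = e
  | _, .val v => by rw [Expr.rename, v.rename_id]
  | _, .app e₁ e₂ => by rw [Expr.rename, e₁.rename_id, e₂.rename_id]
  | _, .fresh e => by rw [Expr.rename, liftRen_id, e.rename_id]
  | _, .reset v e => by rw [Expr.rename, v.rename_id, e.rename_id]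
  | _, .grab v e => by rw [Expr.rename, v.rename_id, liftRen_id, e.rename_id]
  | _, .throw v e => by rw [Expr.rename, v.rename_id, e.rename_id]

theorem Val.rename_id : ∀ {n : ℕ} (v : Val n), v.rename id = v
  | _, .var i => by rw [Val.rename]; rfl
  | _, .lam e => by rw [Val.rename, liftRen_id, e.rename_id]
  | _, .prompt p => by rw [Val.rename]
  | _, .cont E => by rw [Val.rename, E.rename_id]

theorem ECtx.rename_id : ∀ {n : ℕ} (E : ECtx n), E.rename id = E
  | _, .hole => by rw [ECtx.rename]
  | _, .appL E e => by rw [ECtx.rename, E.rename_id, e.rename_id]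
  | _, .appR v E => by rw [ECtx.rename, v.rename_id, E.rename_id]
  | _, .reset p E => by rw [ECtx.rename, E.rename_id]

end

mutual

theorem Expr.rename_rename : ∀ {n m k : ℕ} (ρ : Fin n → Fin m) (ρ' : Fin m → Fin k)
    (e : Expr n), (e.rename ρ).rename ρ' = e.rename (fun i => ρ' (ρ i))
  | _, _, _, ρ, ρ', .val v => by simp only [Expr.rename, v.rename_rename]
  | _, _, _, ρ, ρ', .app e₁ e₂ => by simp only [Expr.rename, e₁.rename_rename, e₂.rename_rename]
  | _, _, _, ρ, ρ', .fresh e => by simp only [Expr.rename, e.rename_rename, liftRen_comp]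
  | _, _, _, ρ, ρ', .reset v e => by simp only [Expr.rename, v.rename_rename, e.rename_rename]
  | _, _, _, ρ, ρ', .grab v e => by
    simp only [Expr.rename, v.rename_rename, e.rename_rename, liftRen_comp]
  | _, _, _, ρ, ρ', .throw v e => by simp only [Expr.rename, v.rename_rename, e.rename_rename]

theorem Val.rename_rename : ∀ {n m k : ℕ} (ρ : Fin n → Fin m) (ρ' : Fin m → Fin k)
    (v : Val n), (v.rename ρ).rename ρ' = v.rename (fun i => ρ' (ρ i))
  | _, _, _, ρ, ρ', .var i => by simp only [Val.rename]
  | _, _, _, ρ, ρ', .lam e => by simp only [Val.rename, e.rename_rename, liftRen_comp]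
  | _, _, _, ρ, ρ', .prompt p => by simp only [Val.rename]
  | _, _, _, ρ, ρ', .cont E => by simp only [Val.rename, E.rename_rename]

theorem ECtx.rename_rename : ∀ {n m k : ℕ} (ρ : Fin n → Fin m) (ρ' : Fin m → Fin k)
    (E : ECtx n), (E.rename ρ).rename ρ' = E.rename (fun i => ρ' (ρ i))
  | _, _, _, ρ, ρ', .hole => by simp only [ECtx.rename]
  | _, _, _, ρ, ρ', .appL E e => by simp only [ECtx.rename, E.rename_rename, e.rename_rename]
  | _, _, _, ρ, ρ', .appR v E => by simp only [ECtx.rename, v.rename_rename, E.rename_rename]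
  | _, _, _, ρ, ρ', .reset p E => by simp only [ECtx.rename, E.rename_rename]

end

mutual

theorem Expr.subst_rename : ∀ {n m k : ℕ} (ρ : Fin n → Fin m) (σ : Fin m → Val k)
    (e : Expr n), (e.rename ρ).subst σ = e.subst (fun i => σ (ρ i))
  | _, _, _, ρ, σ, .val v => by simp only [Expr.rename, Expr.subst, v.subst_rename]
  | _, _, _, ρ, σ, .app e₁ e₂ => by
    simp only [Expr.rename, Expr.subst, e₁.subst_rename, e₂.subst_rename]
  | _, _, _, ρ, σ, .fresh e => by
    simp only [Expr.rename, Expr.subst, e.subst_rename, liftSub_liftRen]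
  | _, _, _, ρ, σ, .reset v e => by
    simp only [Expr.rename, Expr.subst, v.subst_rename, e.subst_rename]
  | _, _, _, ρ, σ, .grab v e => by
    simp only [Expr.rename, Expr.subst, v.subst_rename, e.subst_rename, liftSub_liftRen]
  | _, _, _, ρ, σ, .throw v e => by
    simp only [Expr.rename, Expr.subst, v.subst_rename, e.subst_rename]

theorem Val.subst_rename : ∀ {n m k : ℕ} (ρ : Fin n → Fin m) (σ : Fin m → Val k)
    (v : Val n), (v.rename ρ).subst σ = v.subst (fun i => σ (ρ i))
  | _, _, _, ρ, σ, .var i => by simp only [Val.rename, Val.subst]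
  | _, _, _, ρ, σ, .lam e => by
    simp only [Val.rename, Val.subst, e.subst_rename, liftSub_liftRen]
  | _, _, _, ρ, σ, .prompt p => by simp only [Val.rename, Val.subst]
  | _, _, _, ρ, σ, .cont E => by simp only [Val.rename, Val.subst, E.subst_rename]

theorem ECtx.subst_rename : ∀ {n m k : ℕ} (ρ : Fin n → Fin m) (σ : Fin m → Val k)
    (E : ECtx n), (E.rename ρ).subst σ = E.subst (fun i => σ (ρ i))
  | _, _, _, ρ, σ, .hole => by simp only [ECtx.rename, ECtx.subst]
  | _, _, _, ρ, σ, .appL E e => by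
    simp only [ECtx.rename, ECtx.subst, E.subst_rename, e.subst_rename]
  | _, _, _, ρ, σ, .appR v E => by
    simp only [ECtx.rename, ECtx.subst, v.subst_rename, E.subst_rename]
  | _, _, _, ρ, σ, .reset p E => by simp only [ECtx.rename, ECtx.subst, E.subst_rename]

end

mutual

theorem Expr.subst_var : ∀ {n m : ℕ} (ρ : Fin n → Fin m) (e : Expr n),
    e.subst (fun i => .var (ρ i)) = e.rename ρ
  | _, _, ρ, .val v => by simp only [Expr.rename, Expr.subst, v.subst_var]
  | _, _, ρ, .app e₁ e₂ => by simp only [Expr.rename, Expr.subst, e₁.subst_var, e₂.subst_var]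
  | _, _, ρ, .fresh e => by simp only [Expr.rename, Expr.subst, liftSub_var, e.subst_var]
  | _, _, ρ, .reset v e => by simp only [Expr.rename, Expr.subst, v.subst_var, e.subst_var]
  | _, _, ρ, .grab v e => by
    simp only [Expr.rename, Expr.subst, v.subst_var, liftSub_var, e.subst_var]
  | _, _, ρ, .throw v e => by simp only [Expr.rename, Expr.subst, v.subst_var, e.subst_var]

theorem Val.subst_var : ∀ {n m : ℕ} (ρ : Fin n → Fin m) (v : Val n),
    v.subst (fun i => .var (ρ i)) = v.rename ρ
  | _, _, ρ, .var i => by simp only [Val.rename, Val.subst]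
  | _, _, ρ, .lam e => by simp only [Val.rename, Val.subst, liftSub_var, e.subst_var]
  | _, _, ρ, .prompt p => by simp only [Val.rename, Val.subst]
  | _, _, ρ, .cont E => by simp only [Val.rename, Val.subst, E.subst_var]

theorem ECtx.subst_var : ∀ {n m : ℕ} (ρ : Fin n → Fin m) (E : ECtx n),
    E.subst (fun i => .var (ρ i)) = E.rename ρ
  | _, _, ρ, .hole => by simp only [ECtx.rename, ECtx.subst]
  | _, _, ρ, .appL E e => by simp only [ECtx.rename, ECtx.subst, E.subst_var, e.subst_var]
  | _, _, ρ, .appR v E => by simp only [ECtx.rename, ECtx.subst, v.subst_var, E.subst_var]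
  | _, _, ρ, .reset p E => by simp only [ECtx.rename, ECtx.subst, E.subst_var]

end

/-- A closed value, seen as a value with `n` free variables. -/
def Val.clo {n : ℕ} (v : Val 0) : Val n := v.rename Fin.elim0

/-- A closed expression, seen as an expression with `n` free variables. -/
def Expr.clo {n : ℕ} (e : Expr 0) : Expr n := e.rename Fin.elim0

theorem Val.rename_closed {n : ℕ} (ρ : Fin 0 → Fin n) (v : Val 0) : v.rename ρ = v.clo := by
  rw [Val.clo, Subsingleton.elim ρ]

theorem Val.subst_closed {n : ℕ} (σ : Fin 0 → Val n) (v : Val 0) : v.subst σ = v.clo := by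
  rw [Val.clo, ← Val.subst_var, Subsingleton.elim σ]

theorem Expr.rename_closed {n : ℕ} (ρ : Fin 0 → Fin n) (e : Expr 0) : e.rename ρ = e.clo := by
  rw [Expr.clo, Subsingleton.elim ρ]

theorem Expr.subst_closed {n : ℕ} (σ : Fin 0 → Val n) (e : Expr 0) : e.subst σ = e.clo := by
  rw [Expr.clo, ← Expr.subst_var, Subsingleton.elim σ]

@[simp] theorem Val.clo_zero (v : Val 0) : (v.clo : Val 0) = v := by
  rw [← Val.rename_closed id, Val.rename_id]

@[simp] theorem Expr.clo_zero (e : Expr 0) : (e.clo : Expr 0) = e := by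
  rw [← Expr.rename_closed id, Expr.rename_id]

@[simp] theorem Val.rename_clo {n m : ℕ} (ρ : Fin n → Fin m) (v : Val 0) :
    (v.clo : Val n).rename ρ = v.clo := by
  rw [Val.clo, Val.rename_rename, Val.rename_closed]

@[simp] theorem Expr.rename_clo {n m : ℕ} (ρ : Fin n → Fin m) (e : Expr 0) :
    (e.clo : Expr n).rename ρ = e.clo := by
  rw [Expr.clo, Expr.rename_rename, Expr.rename_closed]

@[simp] theorem Val.subst_clo {n m : ℕ} (σ : Fin n → Val m) (v : Val 0) :
    (v.clo : Val n).subst σ = v.clo := by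
  rw [Val.clo, Val.subst_rename, Val.subst_closed]

@[simp] theorem Expr.subst_clo {n m : ℕ} (σ : Fin n → Val m) (e : Expr 0) :
    (e.clo : Expr n).subst σ = e.clo := by
  rw [Expr.clo, Expr.subst_rename, Expr.subst_closed]

/-! ## Prompts of renamings and substitutions -/

mutual

theorem Expr.prompts_rename : ∀ {n m : ℕ} (ρ : Fin n → Fin m) (e : Expr n),
    (e.rename ρ).prompts = e.prompts
  | _, _, ρ, .val v => by simp only [Expr.rename, Expr.prompts, v.prompts_rename]
  | _, _, ρ, .app e₁ e₂ => by
    simp only [Expr.rename, Expr.prompts, e₁.prompts_rename, e₂.prompts_rename]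
  | _, _, ρ, .fresh e => by simp only [Expr.rename, Expr.prompts, e.prompts_rename]
  | _, _, ρ, .reset v e => by
    simp only [Expr.rename, Expr.prompts, v.prompts_rename, e.prompts_rename]
  | _, _, ρ, .grab v e => by
    simp only [Expr.rename, Expr.prompts, v.prompts_rename, e.prompts_rename]
  | _, _, ρ, .throw v e => by
    simp only [Expr.rename, Expr.prompts, v.prompts_rename, e.prompts_rename]

theorem Val.prompts_rename : ∀ {n m : ℕ} (ρ : Fin n → Fin m) (v : Val n),
    (v.rename ρ).prompts = v.prompts
  | _, _, ρ, .var i => by simp only [Val.rename, Val.prompts]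
  | _, _, ρ, .lam e => by simp only [Val.rename, Val.prompts, e.prompts_rename]
  | _, _, ρ, .prompt p => by simp only [Val.rename, Val.prompts]
  | _, _, ρ, .cont E => by simp only [Val.rename, Val.prompts, E.prompts_rename]

theorem ECtx.prompts_rename : ∀ {n m : ℕ} (ρ : Fin n → Fin m) (E : ECtx n),
    (E.rename ρ).prompts = E.prompts
  | _, _, ρ, .hole => by simp only [ECtx.rename, ECtx.prompts]
  | _, _, ρ, .appL E e => by
    simp only [ECtx.rename, ECtx.prompts, E.prompts_rename, e.prompts_rename]
  | _, _, ρ, .appR v E => by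
    simp only [ECtx.rename, ECtx.prompts, v.prompts_rename, E.prompts_rename]
  | _, _, ρ, .reset p E => by simp only [ECtx.rename, ECtx.prompts, E.prompts_rename]

end

@[simp] theorem Val.prompts_clo {n : ℕ} (v : Val 0) : (v.clo : Val n).prompts = v.prompts :=
  Val.prompts_rename _ _

@[simp] theorem Expr.prompts_clo {n : ℕ} (e : Expr 0) : (e.clo : Expr n).prompts = e.prompts :=
  Expr.prompts_rename _ _

theorem prompts_liftSub {n m : ℕ} {σ : Fin n → Val m} {S : Finset Prompt}
    (h : ∀ i, (σ i).prompts ⊆ S) (i : Fin (n + 1)) : (liftSub σ i).prompts ⊆ S := by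
  cases i using Fin.cases with
  | zero => simp [liftSub, Val.prompts]
  | succ i => simpa [liftSub, Val.prompts_rename] using h i

mutual

theorem Expr.prompts_subst : ∀ {n m : ℕ} {σ : Fin n → Val m} {S : Finset Prompt} (e : Expr n),
    (∀ i, (σ i).prompts ⊆ S) → (e.subst σ).prompts ⊆ e.prompts ∪ S
  | _, _, σ, S, .val v, h => by simpa only [Expr.subst, Expr.prompts] using v.prompts_subst h
  | _, _, σ, S, .app e₁ e₂, h => by
    have h₁ := e₁.prompts_subst h
    have h₂ := e₂.prompts_subst h
    simp only [Expr.subst, Expr.prompts]; grind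
  | _, _, σ, S, .fresh e, h => by
    simpa only [Expr.subst, Expr.prompts] using e.prompts_subst (prompts_liftSub h)
  | _, _, σ, S, .reset v e, h => by
    have h₁ := v.prompts_subst h
    have h₂ := e.prompts_subst h
    simp only [Expr.subst, Expr.prompts]; grind
  | _, _, σ, S, .grab v e, h => by
    have h₁ := v.prompts_subst h
    have h₂ := e.prompts_subst (prompts_liftSub h)
    simp only [Expr.subst, Expr.prompts]; grind
  | _, _, σ, S, .throw v e, h => by
    have h₁ := v.prompts_subst h
    have h₂ := e.prompts_subst h
    simp only [Expr.subst, Expr.prompts]; grind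

theorem Val.prompts_subst : ∀ {n m : ℕ} {σ : Fin n → Val m} {S : Finset Prompt} (v : Val n),
    (∀ i, (σ i).prompts ⊆ S) → (v.subst σ).prompts ⊆ v.prompts ∪ S
  | _, _, σ, S, .var i, h => by simpa only [Val.subst, Val.prompts, Finset.empty_union] using h i
  | _, _, σ, S, .lam e, h => by
    simpa only [Val.subst, Val.prompts] using e.prompts_subst (prompts_liftSub h)
  | _, _, σ, S, .prompt p, h => by simp [Val.subst, Val.prompts]
  | _, _, σ, S, .cont E, h => by simpa only [Val.subst, Val.prompts] using E.prompts_subst h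

theorem ECtx.prompts_subst : ∀ {n m : ℕ} {σ : Fin n → Val m} {S : Finset Prompt} (E : ECtx n),
    (∀ i, (σ i).prompts ⊆ S) → (E.subst σ).prompts ⊆ E.prompts ∪ S
  | _, _, σ, S, .hole, h => by simp [ECtx.subst, ECtx.prompts]
  | _, _, σ, S, .appL E e, h => by
    have h₁ := E.prompts_subst h
    have h₂ := e.prompts_subst h
    simp only [ECtx.subst, ECtx.prompts]; grind
  | _, _, σ, S, .appR v E, h => by
    have h₁ := v.prompts_subst h
    have h₂ := E.prompts_subst h
    simp only [ECtx.subst, ECtx.prompts]; grind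
  | _, _, σ, S, .reset p E, h => by
    have h₁ := E.prompts_subst h
    simp only [ECtx.subst, ECtx.prompts]; grind

end

theorem Expr.prompts_inst {n : ℕ} (e : Expr (n + 1)) (v : Val n) :
    (e.inst v).prompts ⊆ e.prompts ∪ v.prompts := by
  refine e.prompts_subst fun i => ?_
  cases i using Fin.cases <;> simp [Val.prompts]

theorem liftSub_eq_or {n m : ℕ} {σ τ : Fin n → Val m} {a : Prompt}
    (h : ∀ i, σ i = τ i ∨ a ∈ (σ i).prompts) (i : Fin (n + 1)) :
    liftSub σ i = liftSub τ i ∨ a ∈ (liftSub σ i).prompts := by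
  cases i using Fin.cases with
  | zero => exact .inl rfl
  | succ i =>
    rcases h i with h | h
    · left; simp [liftSub, h]
    · right; simpa [liftSub, Val.prompts_rename] using h

mutual

/-- Substitutions that differ only in values with a prompt that does not appear have the same
result. -/
theorem Expr.subst_congr : ∀ {n m : ℕ} {σ τ : Fin n → Val m} {a : Prompt} (e : Expr n),
    (∀ i, σ i = τ i ∨ a ∈ (σ i).prompts) → a ∉ (e.subst σ).prompts → e.subst σ = e.subst τ
  | _, _, σ, τ, a, .val v, h, ha => by
    simp only [Expr.subst, Expr.prompts] at ha ⊢
    rw [v.subst_congr h ha]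
  | _, _, σ, τ, a, .app e₁ e₂, h, ha => by
    simp only [Expr.subst, Expr.prompts, Finset.mem_union, not_or] at ha ⊢
    rw [e₁.subst_congr h ha.1, e₂.subst_congr h ha.2]
  | _, _, σ, τ, a, .fresh e, h, ha => by
    simp only [Expr.subst, Expr.prompts] at ha ⊢
    rw [e.subst_congr (liftSub_eq_or h) ha]
  | _, _, σ, τ, a, .reset v e, h, ha => by
    simp only [Expr.subst, Expr.prompts, Finset.mem_union, not_or] at ha ⊢
    rw [v.subst_congr h ha.1, e.subst_congr h ha.2]
  | _, _, σ, τ, a, .grab v e, h, ha => by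
    simp only [Expr.subst, Expr.prompts, Finset.mem_union, not_or] at ha ⊢
    rw [v.subst_congr h ha.1, e.subst_congr (liftSub_eq_or h) ha.2]
  | _, _, σ, τ, a, .throw v e, h, ha => by
    simp only [Expr.subst, Expr.prompts, Finset.mem_union, not_or] at ha ⊢
    rw [v.subst_congr h ha.1, e.subst_congr h ha.2]

theorem Val.subst_congr : ∀ {n m : ℕ} {σ τ : Fin n → Val m} {a : Prompt} (v : Val n),
    (∀ i, σ i = τ i ∨ a ∈ (σ i).prompts) → a ∉ (v.subst σ).prompts → v.subst σ = v.subst τ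
  | _, _, σ, τ, a, .var i, h, ha => by
    simp only [Val.subst] at ha ⊢
    exact (h i).resolve_right ha
  | _, _, σ, τ, a, .lam e, h, ha => by
    simp only [Val.subst, Val.prompts] at ha ⊢
    rw [e.subst_congr (liftSub_eq_or h) ha]
  | _, _, σ, τ, a, .prompt p, h, ha => by simp only [Val.subst]
  | _, _, σ, τ, a, .cont E, h, ha => by
    simp only [Val.subst, Val.prompts] at ha ⊢
    rw [E.subst_congr h ha]

theorem ECtx.subst_congr : ∀ {n m : ℕ} {σ τ : Fin n → Val m} {a : Prompt} (E : ECtx n),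
    (∀ i, σ i = τ i ∨ a ∈ (σ i).prompts) → a ∉ (E.subst σ).prompts → E.subst σ = E.subst τ
  | _, _, σ, τ, a, .hole, h, ha => by simp only [ECtx.subst]
  | _, _, σ, τ, a, .appL E e, h, ha => by
    simp only [ECtx.subst, ECtx.prompts, Finset.mem_union, not_or] at ha ⊢
    rw [E.subst_congr h ha.1, e.subst_congr h ha.2]
  | _, _, σ, τ, a, .appR v E, h, ha => by
    simp only [ECtx.subst, ECtx.prompts, Finset.mem_union, not_or] at ha ⊢
    rw [v.subst_congr h ha.1, E.subst_congr h ha.2]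
  | _, _, σ, τ, a, .reset p E, h, ha => by
    simp only [ECtx.subst, ECtx.prompts, Finset.mem_union, not_or] at ha ⊢
    rw [E.subst_congr h ha.2]

end

theorem Expr.inst_prompt_eq {e : Expr 1} {a : Prompt} (ha : a ∉ (e.inst (.prompt a)).prompts)
    (c : Prompt) : e.inst (.prompt a) = e.inst (.prompt c) := by
  refine e.subst_congr (fun i => ?_) ha
  cases i using Fin.cases with
  | zero => right; simp [Val.prompts]
  | succ i => exact i.elim0

/-! ## Evaluation contexts -/

theorem ECtx.plug_comp {n : ℕ} (E E' : ECtx n) (e : Expr n) :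
    (E.comp E').plug e = E.plug (E'.plug e) := by
  match E with
  | .hole => rfl
  | .appL E e' => simp only [ECtx.comp, ECtx.plug, E.plug_comp]
  | .appR v E => simp only [ECtx.comp, ECtx.plug, E.plug_comp]
  | .reset p E => simp only [ECtx.comp, ECtx.plug, E.plug_comp]

theorem ECtx.comp_assoc {n : ℕ} (E E' E'' : ECtx n) :
    (E.comp E').comp E'' = E.comp (E'.comp E'') := by
  match E with
  | .hole => rfl
  | .appL E e' => simp only [ECtx.comp, E.comp_assoc]
  | .appR v E => simp only [ECtx.comp, E.comp_assoc]
  | .reset p E => simp only [ECtx.comp, E.comp_assoc]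

theorem ECtx.prompts_plug {n : ℕ} (E : ECtx n) (e : Expr n) :
    (E.plug e).prompts = E.prompts ∪ e.prompts := by
  match E with
  | .hole => simp [ECtx.plug, ECtx.prompts]
  | .appL E e' =>
    simp only [ECtx.plug, Expr.prompts, ECtx.prompts, E.prompts_plug]
    ext; simp only [Finset.mem_union]; tauto
  | .appR v E =>
    simp only [ECtx.plug, Expr.prompts, ECtx.prompts, E.prompts_plug, Finset.union_assoc]
  | .reset p E =>
    simp only [ECtx.plug, Expr.prompts, Val.prompts, ECtx.prompts, E.prompts_plug,
      Finset.union_assoc]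

theorem ECtx.prompts_comp {n : ℕ} (E E' : ECtx n) :
    (E.comp E').prompts = E.prompts ∪ E'.prompts := by
  match E with
  | .hole => simp [ECtx.comp, ECtx.prompts]
  | .appL E e' =>
    simp only [ECtx.comp, ECtx.prompts, E.prompts_comp]
    ext; simp only [Finset.mem_union]; tauto
  | .appR v E => simp only [ECtx.comp, ECtx.prompts, E.prompts_comp, Finset.union_assoc]
  | .reset p E => simp only [ECtx.comp, ECtx.prompts, E.prompts_comp, Finset.union_assoc]

section surrounding

variable {n : ℕ} {p q : Prompt}

@[simp] theorem ECtx.mem_surrounding_hole : ¬ p ∈ (ECtx.hole : ECtx n).surrounding := by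
  rintro ⟨E₁, E₂, h⟩
  cases E₁ <;> simp [ECtx.comp] at h

@[simp] theorem ECtx.mem_surrounding_appL {E : ECtx n} {e : Expr n} :
    p ∈ (ECtx.appL E e).surrounding ↔ p ∈ E.surrounding := by
  constructor
  · rintro ⟨E₁, E₂, h⟩
    cases E₁ <;> simp [ECtx.comp] at h
    exact ⟨_, _, h.1⟩
  · rintro ⟨E₁, E₂, rfl⟩
    exact ⟨.appL E₁ e, E₂, rfl⟩

@[simp] theorem ECtx.mem_surrounding_appR {E : ECtx n} {v : Val n} :
    p ∈ (ECtx.appR v E).surrounding ↔ p ∈ E.surrounding := by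
  constructor
  · rintro ⟨E₁, E₂, h⟩
    cases E₁ <;> simp [ECtx.comp] at h
    exact ⟨_, _, h.2⟩
  · rintro ⟨E₁, E₂, rfl⟩
    exact ⟨.appR v E₁, E₂, rfl⟩

@[simp] theorem ECtx.mem_surrounding_reset {E : ECtx n} :
    p ∈ (ECtx.reset q E).surrounding ↔ p = q ∨ p ∈ E.surrounding := by
  constructor
  · rintro ⟨E₁, E₂, h⟩
    cases E₁ <;> simp [ECtx.comp] at h
    · exact .inl h.1.symm
    · exact .inr ⟨_, _, h.2⟩
  · rintro (rfl | ⟨E₁, E₂, rfl⟩)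
    · exact ⟨.hole, E, rfl⟩
    · exact ⟨.reset q E₁, E₂, rfl⟩

@[simp] theorem ECtx.mem_surrounding_comp {E E' : ECtx n} :
    p ∈ (E.comp E').surrounding ↔ p ∈ E.surrounding ∨ p ∈ E'.surrounding := by
  match E with
  | .hole => simp [ECtx.comp]
  | .appL E e => simp [ECtx.comp, E.mem_surrounding_comp]
  | .appR v E => simp [ECtx.comp, E.mem_surrounding_comp]
  | .reset q E => simp [ECtx.comp, E.mem_surrounding_comp, or_assoc]

theorem ECtx.exists_innermost {E : ECtx n} (h : p ∈ E.surrounding) :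
    ∃ E₁ E₂ : ECtx n, E = E₁.comp (.reset p E₂) ∧ p ∉ E₂.surrounding := by
  match E with
  | .hole => simp at h
  | .appL E e =>
    obtain ⟨E₁, E₂, rfl, hp⟩ := ECtx.exists_innermost (E := E) (by simpa using h)
    exact ⟨.appL E₁ e, E₂, rfl, hp⟩
  | .appR v E =>
    obtain ⟨E₁, E₂, rfl, hp⟩ := ECtx.exists_innermost (E := E) (by simpa using h)
    exact ⟨.appR v E₁, E₂, rfl, hp⟩
  | .reset q E =>
    by_cases hE : p ∈ E.surrounding
    · obtain ⟨E₁, E₂, rfl, hp⟩ := ECtx.exists_innermost (E := E) hE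
      exact ⟨.reset q E₁, E₂, rfl, hp⟩
    · obtain rfl : p = q := by simpa [hE] using h
      exact ⟨.hole, E, rfl, hE⟩

theorem ECtx.innermost_unique {E₁ E₂ E₁' E₂' : ECtx n}
    (h : E₁.comp (.reset p E₂) = E₁'.comp (.reset p E₂'))
    (hp : p ∉ E₂.surrounding) (hp' : p ∉ E₂'.surrounding) : E₁ = E₁' ∧ E₂ = E₂' := by
  match E₁, E₁' with
  | .hole, .hole => simpa [ECtx.comp] using h
  | .appL E e, .appL E' e' =>
    simp only [ECtx.comp, ECtx.appL.injEq] at h ⊢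
    have := ECtx.innermost_unique h.1 hp hp'
    grind
  | .appR v E, .appR v' E' =>
    simp only [ECtx.comp, ECtx.appR.injEq] at h ⊢
    have := ECtx.innermost_unique h.2 hp hp'
    grind
  | .reset v E, .reset v' E' =>
    simp only [ECtx.comp, ECtx.reset.injEq] at h ⊢
    have := ECtx.innermost_unique h.2 hp hp'
    grind
  | .hole, .reset v' E' =>
    simp only [ECtx.comp, ECtx.reset.injEq] at h
    exact absurd (h.2 ▸ by simp) hp
  | .reset v' E', .hole =>
    simp only [ECtx.comp, ECtx.reset.injEq] at h
    exact absurd (h.2 ▸ by simp) hp'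
  | .hole, .appL _ _ | .hole, .appR _ _ | .appL _ _, .hole | .appR _ _, .hole => simp [ECtx.comp] at h
  | .appL _ _, .appR _ _ | .appL _ _, .reset _ _ | .appR _ _, .appL _ _ => simp [ECtx.comp] at h
  | .appR _ _, .reset _ _ | .reset _ _, .appL _ _ | .reset _ _, .appR _ _ => simp [ECtx.comp] at h

end surrounding

/-! ## Unique decomposition and the shape of reductions -/

/-- Expressions that are neither values nor can be decomposed further by an evaluation context. -/
inductive PotRedex : Expr 0 → Prop
  | app (v w : Val 0) : PotRedex (.app (.val v) (.val w))
  | resetVal (v w : Val 0) : PotRedex (.reset v (.val w))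
  | resetBad (v : Val 0) (e : Expr 0) (hv : ∀ p, v ≠ .prompt p) : PotRedex (.reset v e)
  | fresh (e : Expr 1) : PotRedex (.fresh e)
  | grab (v : Val 0) (e : Expr 1) : PotRedex (.grab v e)
  | throw (v : Val 0) (e : Expr 0) : PotRedex (.throw v e)

theorem PotRedex.plug_ne_val {r : Expr 0} (hr : PotRedex r) (E : ECtx 0) (v : Val 0) :
    E.plug r ≠ .val v := by
  cases E <;> simp only [ECtx.plug] <;> (try cases hr) <;> simp

theorem PotRedex.eq_of_plug_eq {r s : Expr 0} (hr : PotRedex r) (hs : PotRedex s) (E : ECtx 0)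
    (h : r = E.plug s) : E = .hole := by
  cases E with
  | hole => rfl
  | appL E e =>
    cases hr <;> simp only [ECtx.plug, Expr.app.injEq, reduceCtorEq] at h
    exact absurd h.1.symm (hs.plug_ne_val _ _)
  | appR v E =>
    cases hr <;> simp only [ECtx.plug, Expr.app.injEq, reduceCtorEq] at h
    exact absurd h.2.symm (hs.plug_ne_val _ _)
  | reset p E =>
    cases hr <;> simp only [ECtx.plug, Expr.reset.injEq, reduceCtorEq] at h
    · exact absurd h.2.symm (hs.plug_ne_val _ _)
    · rename_i hv
      exact absurd h.1 (hv p)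

/-- Uniqueness of the decomposition into an evaluation context and a potential redex. -/
theorem plug_unique {r s : Expr 0} (hr : PotRedex r) (hs : PotRedex s) {E F : ECtx 0}
    (h : E.plug r = F.plug s) : E = F ∧ r = s := by
  match E, F with
  | .hole, F =>
    obtain rfl := hr.eq_of_plug_eq hs F h
    exact ⟨rfl, h⟩
  | E, .hole =>
    obtain rfl := hs.eq_of_plug_eq hr E h.symm
    exact ⟨rfl, h⟩
  | .appL E e, .appL F f =>
    simp only [ECtx.plug, Expr.app.injEq] at h
    have := plug_unique hr hs h.1
    grind
  | .appR v E, .appR w F =>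
    simp only [ECtx.plug, Expr.app.injEq, Expr.val.injEq] at h
    have := plug_unique hr hs h.2
    grind
  | .reset p E, .reset q F =>
    simp only [ECtx.plug, Expr.reset.injEq, Val.prompt.injEq] at h
    have := plug_unique hr hs h.2
    grind
  | .appL E e, .appR w F =>
    simp only [ECtx.plug, Expr.app.injEq] at h
    exact absurd h.1 (hr.plug_ne_val _ _)
  | .appR w E, .appL F e =>
    simp only [ECtx.plug, Expr.app.injEq] at h
    exact absurd h.1.symm (hs.plug_ne_val _ _)
  | .appL _ _, .reset _ _ | .appR _ _, .reset _ _ => simp [ECtx.plug] at h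
  | .reset _ _, .appL _ _ | .reset _ _, .appR _ _ => simp [ECtx.plug] at h

/-- The contractions of redexes that do not involve the context, except prompt generation. -/
inductive Contract : Expr 0 → Expr 0 → Prop
  | beta (e : Expr 1) (v : Val 0) : Contract (.app (.val (.lam e)) (.val v)) (e.inst v)
  | resetVal (p : Prompt) (v : Val 0) : Contract (.reset (.prompt p) (.val v)) (.val v)
  | throw (E : ECtx 0) (e : Expr 0) : Contract (.throw (.cont E) e) (E.plug e)

theorem Contract.potRedex {r r₁ : Expr 0} (h : Contract r r₁) : PotRedex r := by
  cases h <;> constructor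

/-- Reductions other than prompt generation. -/
inductive Det : Expr 0 → Expr 0 → Prop
  | contract (E : ECtx 0) {r r₁ : Expr 0} (h : Contract r r₁) : Det (E.plug r) (E.plug r₁)
  | capture (E : ECtx 0) (p : Prompt) (E₂ : ECtx 0) (b : Expr 1) (hp : p ∉ E₂.surrounding) :
      Det ((E.comp (.reset p E₂)).plug (.grab (.prompt p) b)) (E.plug (b.inst (.cont E₂)))

theorem Det.plug (F : ECtx 0) {e e₁ : Expr 0} (h : Det e e₁) : Det (F.plug e) (F.plug e₁) := by
  cases h with
  | contract E h =>
    rw [← ECtx.plug_comp, ← ECtx.plug_comp]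
    exact .contract _ h
  | capture E p E₂ b hp =>
    rw [← ECtx.plug_comp, ← ECtx.plug_comp, ← ECtx.comp_assoc]
    exact .capture _ p E₂ b hp

theorem Contract.det {r r₁ : Expr 0} (h : Contract r r₁) : Det r r₁ := .contract .hole h

theorem Det.not_isValue {e e₁ : Expr 0} (h : Det e e₁) : ¬ e.IsValue := by
  rintro ⟨v, rfl⟩
  generalize he : Expr.val v = e at h
  cases h with
  | contract E h => exact h.potRedex.plug_ne_val _ _ he.symm
  | capture E p E₂ b hp => exact (PotRedex.grab _ _).plug_ne_val _ _ he.symm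

theorem Contract.unique {r r₁ r₂ : Expr 0} (h₁ : Contract r r₁) (h₂ : Contract r r₂) :
    r₁ = r₂ := by
  cases h₁ <;> cases h₂ <;> rfl

theorem Det.unique {e e₁ e₂ : Expr 0} (h₁ : Det e e₁) (h₂ : Det e e₂) : e₁ = e₂ := by
  cases h₁ with
  | contract E h =>
    rename_i r r₁
    generalize he : E.plug r = e at h₂
    cases h₂ with
    | contract E' h' =>
      obtain ⟨rfl, rfl⟩ := plug_unique h.potRedex h'.potRedex he
      rw [h.unique h']
    | capture E' p E₂ b hp =>
      obtain ⟨rfl, rfl⟩ := plug_unique h.potRedex (.grab _ _) he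
      cases h
  | capture E p E₂ b hp =>
    generalize he : (E.comp (.reset p E₂)).plug (.grab (.prompt p) b) = e at h₂
    cases h₂ with
    | contract E' h' =>
      obtain ⟨rfl, rfl⟩ := plug_unique (.grab _ _) h'.potRedex he
      cases h'
    | capture E' p' E₂' b' hp' =>
      obtain ⟨h, h'⟩ := plug_unique (.grab _ _) (.grab _ _) he
      simp only [Expr.grab.injEq, Val.prompt.injEq] at h'
      obtain ⟨rfl, rfl⟩ := h'
      obtain ⟨rfl, rfl⟩ := ECtx.innermost_unique h hp hp'
      rfl

theorem Contract.prompts_subset {r r₁ : Expr 0} (h : Contract r r₁) : r₁.prompts ⊆ r.prompts := by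
  cases h with
  | beta e v => simpa [Expr.prompts, Val.prompts] using e.prompts_inst v
  | resetVal p v => simp [Expr.prompts, Val.prompts]
  | throw E e => simp [Expr.prompts, Val.prompts, ECtx.prompts_plug]

theorem Det.prompts_subset {e e₁ : Expr 0} (h : Det e e₁) : e₁.prompts ⊆ e.prompts := by
  cases h with
  | contract E h =>
    rw [ECtx.prompts_plug, ECtx.prompts_plug]
    exact Finset.union_subset_union_right h.prompts_subset
  | capture E p E₂ b hp =>
    have := b.prompts_inst (.cont E₂)
    simp only [ECtx.prompts_plug, ECtx.prompts_comp, ECtx.prompts, Expr.prompts, Val.prompts]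
      at this ⊢
    grind

theorem Det.red {e e₁ : Expr 0} (h : Det e e₁) : Red e e₁ := by
  cases h with
  | contract E h =>
    refine .compat E _ _ ?_ ?_
    · cases h <;> constructor
    · rw [Finset.sdiff_eq_empty_iff_subset.2 h.prompts_subset, Finset.empty_inter]
  | capture E p E₂ b hp =>
    rw [ECtx.plug_comp]
    refine .compat E _ _ (.capture p E₂ b hp) ?_
    have := (Det.capture .hole p E₂ b hp).prompts_subset
    simp only [ECtx.comp, ECtx.plug] at this ⊢
    rw [Finset.sdiff_eq_empty_iff_subset.2 this, Finset.empty_inter]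

/-- A reduction generates a prompt, or is one of the deterministic ones. -/
theorem Red.det_or_fresh {e e₁ : Expr 0} (h : Red e e₁) :
    Det e e₁ ∨ ∃ (E : ECtx 0) (b : Expr 1) (a : Prompt), e = E.plug (.fresh b) ∧
      e₁ = E.plug (b.inst (.prompt a)) ∧ a ∉ b.prompts ∧
      ((b.inst (.prompt a)).prompts \ b.prompts) ∩ E.prompts = ∅ := by
  induction h with
  | beta e v => exact .inl (Contract.beta e v).det
  | resetVal p v => exact .inl (Contract.resetVal p v).det
  | capture p E e hp => exact .inl (Det.capture .hole p E e hp)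
  | throw E e => exact .inl (Contract.throw E e).det
  | fresh p e hp => exact .inr ⟨.hole, e, p, rfl, rfl, hp, by simp [ECtx.prompts]⟩
  | compat F e₁ e₂ h hfresh ih =>
    rcases ih with ih | ⟨E, b, a, rfl, rfl, ha, hE⟩
    · exact .inl (ih.plug F)
    · refine .inr ⟨F.comp E, b, a, (ECtx.plug_comp ..).symm, (ECtx.plug_comp ..).symm, ha, ?_⟩
      simp only [ECtx.prompts_plug, ECtx.prompts_comp, Expr.prompts, Finset.eq_empty_iff_forall_notMem,
        Finset.mem_inter, Finset.mem_sdiff, Finset.mem_union] at hfresh hE ⊢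
      intro x hx
      have := hfresh x
      have := hE x
      tauto

theorem Red.fresh_plug {E : ECtx 0} {b : Expr 1} {a : Prompt} (hb : a ∉ b.prompts)
    (hE : a ∉ E.prompts) : Red (E.plug (.fresh b)) (E.plug (b.inst (.prompt a))) := by
  refine .compat E _ _ (.fresh a b hb) ?_
  have := b.prompts_inst (.prompt a)
  simp only [Finset.eq_empty_iff_forall_notMem, Expr.prompts, Val.prompts] at this ⊢
  grind

theorem Red.potRedex {e e₁ : Expr 0} (h : Red e e₁) {E : ECtx 0} {r : Expr 0} (hr : PotRedex r)
    (he : e = E.plug r) : (∃ r₁, Contract r r₁) ∨ (∃ b, r = .fresh b) ∨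
      ∃ p b, r = .grab (.prompt p) b ∧ p ∈ E.surrounding := by
  rcases h.det_or_fresh with hd | ⟨E', b, a, rfl, rfl, -⟩
  · cases hd with
    | contract E' hc =>
      obtain ⟨rfl, rfl⟩ := plug_unique hc.potRedex hr he
      exact .inl ⟨_, hc⟩
    | capture E' p E₂ b hp =>
      obtain ⟨rfl, rfl⟩ := plug_unique (.grab _ _) hr he
      exact .inr (.inr ⟨p, b, rfl, by simp⟩)
  · obtain ⟨rfl, rfl⟩ := plug_unique (.fresh _) hr he
    exact .inr (.inl ⟨b, rfl⟩)

theorem Det.eq_of_red {e e₁ e₂ : Expr 0} (h : Det e e₁) (h' : Red e e₂) : e₂ = e₁ := by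
  rcases h'.det_or_fresh with h' | ⟨E', b, a, rfl, rfl, -⟩
  · exact h'.unique h
  · generalize he : E'.plug (.fresh b) = e at h
    cases h with
    | contract E h =>
      obtain ⟨rfl, rfl⟩ := plug_unique (.fresh _) h.potRedex he
      cases h
    | capture E p E₂ b hp =>
      obtain ⟨rfl, h⟩ := plug_unique (.fresh _) (.grab _ _) he
      cases h

/-- Sequences of deterministic reductions. -/
abbrev Dets : Expr 0 → Expr 0 → Prop := Relation.ReflTransGen Det

theorem Dets.plug (F : ECtx 0) {e e₁ : Expr 0} (h : Dets e e₁) : Dets (F.plug e) (F.plug e₁) :=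
  Relation.ReflTransGen.lift F.plug (fun _ _ h' => Det.plug F h') _ _ h

theorem Contract.cast {e e₁ e₂ : Expr 0} (h : Contract e e₁) (he : e₁ = e₂) : Contract e e₂ :=
  he ▸ h

/-! ## The two handlers at run time -/

/-- The function that raises an exception with the handler `h` of the prompt `x`. -/
def raiseL (x : Prompt) (h : Val 0) : Val 0 :=
  .lam (.grab (.prompt x) (.app (.val h.clo) (ev 1)))

/-- An exception raised by `raiseL`. -/
def grabL {n : ℕ} (x : Prompt) (h z : Val 0) : Expr n :=
  .grab (.prompt x) (.app (.val h.clo) (.val z.clo))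

/-- `handle` after its first argument. -/
def partialL (f : Val 0) : Val 0 :=
  .lam (.fresh (.reset (vr 0)
    (.app (.val f.clo) (.val (.lam (.grab (vr 1) (.app (ev 3) (ev 1))))))))

/-- `handle` after both arguments. -/
def bodyL (f h : Val 0) : Expr 0 :=
  .fresh (.reset (vr 0)
    (.app (.val f.clo) (.val (.lam (.grab (vr 1) (.app (.val h.clo) (ev 1)))))))

/-- `λ r. λ _. λ _. r`. -/
def constV {n : ℕ} : Val n := .lam (.val (.lam (.val (.lam (ev 2)))))

/-- A computation under the handler `h` with name `y`. -/
def handlerR {n : ℕ} (p y : Prompt) (h : Val 0) (e : Expr n) : Expr n :=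
  .app (.app (.reset (.prompt p) (.app (.val constV) e)) (.val (.prompt y))) (.val h.clo)

/-- The evaluation context under the handler `h` with name `y`. -/
def handlerCtx {n : ℕ} (p y : Prompt) (h : Val 0) (E : ECtx n) : ECtx n :=
  .appL (.appL (.reset p (.appR constV E)) (.val (.prompt y))) (.val h.clo)

/-- The function that raises an exception with the name `y`. -/
def raiseR (p y : Prompt) : Val 0 := raise p (.prompt y)

/-- The function passed to the handlers, which compares `y` with their names. -/
def abortV (p y : Prompt) (z : Val 0) : Val 0 :=
  .lam (.val (.lam (ifE (eqE (.val (.prompt y)) (ev 1)) (.app (ev 0) (.val z.clo))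
    (.app (.val (raiseR p y).clo) (.val z.clo)))))

/-- An exception raised by `raiseR`. -/
def grabR {n : ℕ} (p y : Prompt) (z : Val 0) : Expr n :=
  .grab (.prompt p) (.val (abortV p y z).clo)

/-- `handleP p` after its first argument. -/
def partialR (p : Prompt) (f : Val 0) : Val 0 :=
  .lam (.fresh (.app (.app (.reset (.prompt p)
      (.app (.val constV) (.app (.val f.clo) (.val (raise p (vr 0))))))
      (ev 0)) (ev 1)))

/-- `handleP p` after both arguments. -/
def bodyR (p : Prompt) (f h : Val 0) : Expr 0 :=
  .fresh (.app (.app (.reset (.prompt p)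
      (.app (.val constV) (.app (.val f.clo) (.val (raise p (vr 0))))))
      (ev 0)) (.val h.clo))

theorem liftSub_clo {n m : ℕ} {σ : Fin n → Val m} {i : Fin n} {v : Val 0} (h : σ i = v.clo) :
    liftSub σ i.succ = v.clo := by
  change (σ i).rename Fin.succ = _
  rw [h, Val.rename_clo]

theorem subst_liftSub_raise {n m : ℕ} (p : Prompt) (σ : Fin n → Val m) :
    (raise p (vr 0) : Val (n + 1)).subst (liftSub σ) = raise p (vr 0) := by
  simp only [raise, fixV, fixAux, Val.subst, Expr.subst, ifE, eqE, letIn, seqE, Expr.up, Val.up,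
    Expr.rename, Val.rename, ev, vr, trueV, falseV]
  rfl

theorem Contract.handle (f : Val 0) :
    Contract (.app (.val handle) (.val f)) (.val (partialL f)) := by
  refine (Contract.beta _ f).cast ?_
  simp only [Expr.inst, Expr.subst, Val.subst, ev, vr, partialL]
  have h : liftSub (liftSub (Fin.cases f Val.var)) (2 : Fin 3) = f.clo :=
    liftSub_clo (i := 1) (liftSub_clo (i := 0) f.clo_zero.symm)
  congr

theorem Contract.partialL (f h : Val 0) :
    Contract (.app (.val (partialL f)) (.val h)) (bodyL f h) := by
  refine (Contract.beta _ h).cast ?_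
  simp only [Expr.inst, Expr.subst, Val.subst, Val.subst_clo, ev, vr, bodyL]
  have h : liftSub (liftSub (liftSub (Fin.cases h Val.var))) (3 : Fin 4) = h.clo :=
    liftSub_clo (i := 2) (liftSub_clo (i := 1) (liftSub_clo (i := 0) h.clo_zero.symm))
  congr

theorem inst_bodyL (f h : Val 0) (x : Prompt) :
    (Expr.reset (vr 0) (.app (.val f.clo)
      (.val (.lam (.grab (vr 1) (.app (.val h.clo) (ev 1)))))) : Expr 1).inst (.prompt x) =
    .reset (.prompt x) (.app (.val f) (.val (raiseL x h))) := by
  simp only [Expr.inst, Expr.subst, Val.subst, Val.subst_clo, ev, vr, raiseL, Val.clo_zero]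
  rfl

theorem Contract.raiseL (x : Prompt) (h z : Val 0) :
    Contract (.app (.val (raiseL x h)) (.val z)) (grabL x h z) := by
  refine (Contract.beta _ z).cast ?_
  simp only [Expr.inst, Expr.subst, Val.subst, Val.subst_clo, ev, vr, grabL]
  have h : liftSub (Fin.cases z Val.var) (1 : Fin 2) = z.clo :=
    liftSub_clo (i := 0) z.clo_zero.symm
  congr

theorem inst_grabL (h z v : Val 0) :
    (Expr.app (.val h.clo) (.val z.clo) : Expr 1).inst v = .app (.val h) (.val z) := by
  simp [Expr.inst, Expr.subst]

theorem Contract.handleP (p : Prompt) (f : Val 0) :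
    Contract (.app (.val (handleP p)) (.val f)) (.val (partialR p f)) := by
  refine (Contract.beta _ f).cast ?_
  have h : liftSub (liftSub (Fin.cases f Val.var)) (2 : Fin 3) = f.clo :=
    liftSub_clo (i := 1) (liftSub_clo (i := 0) f.clo_zero.symm)
  simp only [letIn, Expr.inst, Expr.subst, Val.subst, ev, vr, partialR, constV]
  have h' := subst_liftSub_raise p (liftSub (Fin.cases f Val.var))
  congr

theorem Contract.partialR (p : Prompt) (f h : Val 0) :
    Contract (.app (.val (partialR p f)) (.val h)) (bodyR p f h) := by
  refine (Contract.beta _ h).cast ?_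
  have h₁ : liftSub (Fin.cases h Val.var) (1 : Fin 2) = h.clo :=
    liftSub_clo (i := 0) h.clo_zero.symm
  simp only [Expr.inst, Expr.subst, Val.subst, Val.subst_clo, ev, vr, bodyR, constV]
  have h' := subst_liftSub_raise p (Fin.cases h Val.var)
  congr

theorem inst_bodyR (p : Prompt) (f h : Val 0) (y : Prompt) :
    (Expr.app (.app (.reset (.prompt p)
      (.app (.val constV) (.app (.val f.clo) (.val (raise p (vr 0))))))
      (ev 0)) (.val h.clo) : Expr 1).inst (.prompt y) =
    handlerR p y h (.app (.val f) (.val (raiseR p y))) := by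
  simp only [Expr.inst, Expr.subst, Val.subst, Val.subst_clo, Val.clo_zero, ev, vr,
    handlerR, constV]
  rfl

theorem Contract.dets {e e₁ : Expr 0} (h : Contract e e₁) : Dets e e₁ := .single h.det

theorem Dets.appL {e e₁ : Expr 0} (h : Dets e e₁) (f : Expr 0) : Dets (.app e f) (.app e₁ f) :=
  h.plug (.appL .hole f)

theorem Dets.beta {e : Expr 1} {v : Val 0} {e₁ : Expr 0} (h : e.inst v = e₁) :
    Dets (.app (.val (.lam e)) (.val v)) e₁ :=
  ((Contract.beta e v).cast h).dets

theorem inst_clo (e : Expr 0) (v : Val 0) : (e.clo : Expr 1).inst v = e := by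
  rw [Expr.inst, Expr.subst_clo, Expr.clo_zero]

theorem inst_up (e : Expr 0) (v : Val 0) : e.up.inst v = e := by
  rw [Expr.up, Expr.rename_closed, inst_clo]

theorem fixAux_dets (e : Expr 2) :
    Dets (.app (.val (fixAux e)) (.val (fixAux e)))
      (.val (.lam (e.subst (liftSub (Fin.cases (fixV e) Val.var))))) := by
  refine .trans (b := .app (.val (.lam (.val (.lam e)))) (.val (fixV e))) (Dets.beta ?_) (Dets.beta ?_)
  · have h : liftSub (Fin.cases (fixAux e) Val.var) (1 : Fin 2) = (fixAux e).clo :=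
      liftSub_clo (i := 0) (fixAux e).clo_zero.symm
    have h' (v : Val 0) : v.up.subst (Fin.cases (fixAux e) Val.var) = v := by
      rw [Val.up, Val.rename_closed, Val.subst_clo, Val.clo_zero]
    simp only [Expr.inst, Expr.subst, h']
    simp only [fixV, Val.up, Val.rename_closed, Val.subst, Expr.subst, ev, vr]
    congr
  · rfl

/-- The body of the recursive function, with the function and its argument as variables. -/
def raiseCore (p y : Prompt) : Expr 2 :=
  .grab (.prompt p) (.val (.lam (.val (.lam
    (ifE (eqE (.val (.prompt y)) (ev 1)) (.app (ev 0) (ev 3)) (.app (ev 4) (ev 3)))))))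

theorem raiseR_eq_fixV (p y : Prompt) : raiseR p y = fixV (raiseCore p y) := rfl

/-- The function to which `raiseR` unfolds. -/
def raiseFun (p y : Prompt) : Val 0 :=
  .lam (.grab (.prompt p) (.val (.lam (.val (.lam
    (ifE (eqE (.val (.prompt y)) (ev 1)) (.app (ev 0) (ev 3))
      (.app (.val (raiseR p y).clo) (ev 3))))))))

/-- The body of the abstraction `raiseR`. -/
def raiseBody (p y : Prompt) : Expr 1 :=
  .app (.app (.val (fixAux (raiseCore p y)).up) (.val (fixAux (raiseCore p y)).up)) (ev 0)

theorem raiseR_eq (p y : Prompt) : raiseR p y = .lam (raiseBody p y) := rfl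

theorem raiseBody_inst (p y : Prompt) (z : Val 0) : (raiseBody p y).inst z =
    .app (.app (.val (fixAux (raiseCore p y))) (.val (fixAux (raiseCore p y)))) (.val z) := by
  simp only [raiseBody, Expr.inst, Expr.subst, Val.up, Val.rename_closed, Val.subst_clo,
    Val.clo_zero, ev, vr, Val.subst]
  rfl

theorem raiseCore_subst (p y : Prompt) :
    .lam ((raiseCore p y).subst (liftSub (Fin.cases (raiseR p y) Val.var))) = raiseFun p y := by
  simp only [raiseFun, raiseCore]
  generalize raiseR p y = z
  have h₄ : liftSub (liftSub (liftSub (liftSub (Fin.cases z Val.var)))) (4 : Fin 5) = z.clo :=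
    liftSub_clo (i := 3) (liftSub_clo (i := 2) (liftSub_clo (i := 1)
      (liftSub_clo (i := 0) z.clo_zero.symm)))
  simp only [Expr.subst, Val.subst, Val.rename, Expr.rename, ev, vr,
    ifE, eqE, letIn, seqE, Expr.up, trueV, falseV, Val.rename_clo]
  congr
  refine liftSub_clo h₄

theorem raiseFun_dets (p y : Prompt) (z : Val 0) :
    Dets (.app (.val (raiseFun p y)) (.val z)) (grabR p y z) := by
  refine Dets.beta ?_
  have h₄ : liftSub (liftSub (liftSub (liftSub (Fin.cases z Val.var)))) (4 : Fin 5) = z.clo :=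
    liftSub_clo (i := 3) (liftSub_clo (i := 2) (liftSub_clo (i := 1)
      (liftSub_clo (i := 0) z.clo_zero.symm)))
  simp only [grabR, abortV, Expr.inst, Expr.subst, Val.subst, Val.rename, Expr.rename, ev, vr,
    ifE, eqE, letIn, seqE, Expr.up, trueV, falseV, Val.clo]
  congr
  all_goals
    refine h₄.trans ?_
    rw [Val.rename_rename, Val.rename_rename, Val.rename_closed]

theorem raiseBody_dets (p y : Prompt) (z : Val 0) :
    Dets ((raiseBody p y).inst z) (grabR p y z) := by
  have h := fixAux_dets (raiseCore p y)
  rw [← raiseR_eq_fixV, raiseCore_subst] at h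
  rw [raiseBody_inst]
  exact (h.appL _).trans (raiseFun_dets p y z)

theorem raiseR_dets (p y : Prompt) (z : Val 0) :
    Dets (.app (.val (raiseR p y)) (.val z)) (grabR p y z) :=
  .trans (Dets.beta rfl) (raiseBody_dets p y z)

/-- The comparison of two given prompts, after the evaluation of its arguments. -/
def eqTest (y y' : Prompt) : Expr 0 :=
  .reset (.prompt y)
    (seqE (.reset (.prompt y') (.grab (.prompt y) (.val falseV))) (.val trueV))

theorem eqE_dets (y y' : Prompt) :
    Dets (eqE (.val (.prompt y)) (.val (.prompt y'))) (eqTest y y') :=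
  .trans (Dets.beta rfl) (Dets.beta rfl)

theorem eqTest_dets_true (y : Prompt) : Dets (eqTest y y) (.val trueV) := by
  refine .trans (b := .reset (.prompt y) (seqE (.val falseV) (.val trueV))) ?_
    (.trans (b := .reset (.prompt y) (.val trueV)) ?_ (Contract.resetVal _ _).dets)
  · exact .single (Det.capture (.reset y (.appR (.lam (Expr.val trueV).up) .hole)) y .hole
      (.val falseV) (by simp))
  · exact Dets.plug (.reset y .hole) (Dets.beta rfl)

theorem eqTest_dets_false {y y' : Prompt} (h : y ≠ y') : Dets (eqTest y y') (.val falseV) :=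
  .single (Det.capture .hole y (.appR (.lam (Expr.val trueV).up) (.reset y' .hole))
    (.val falseV) (by simpa using h))

theorem Dets.ifE {e e' : Expr 0} (h : Dets e e') (e₁ e₂ : Expr 0) :
    Dets (DelimControl.ifE e e₁ e₂) (DelimControl.ifE e' e₁ e₂) :=
  ((h.appL _).appL _).appL _

theorem ifE_dets_true (e₁ e₂ : Expr 0) : Dets (ifE (.val trueV) e₁ e₂) e₁ := by
  refine .trans (b := .app (.val (.lam e₁.up)) (.val (.lam (ev 0)))) ?_ (Dets.beta ?_)
  · refine Dets.appL (.trans (b := .app (.val (.lam (.val (Val.lam e₁.up).up)))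
      (.val (.lam e₂.up))) (Dets.appL (Dets.beta ?_) _) (Dets.beta ?_)) _
    · rfl
    · exact inst_up (.val (.lam e₁.up)) _
  · exact inst_up _ _

theorem ifE_dets_false (e₁ e₂ : Expr 0) : Dets (ifE (.val falseV) e₁ e₂) e₂ := by
  refine .trans (b := .app (.val (.lam e₂.up)) (.val (.lam (ev 0)))) ?_ (Dets.beta ?_)
  · refine Dets.appL (.trans (b := .app (.val (.lam (ev 0))) (.val (.lam e₂.up)))
      (Dets.appL (Dets.beta rfl) _) (Dets.beta rfl)) _
  · exact inst_up _ _

/-- The call of the aborting function at a handler. -/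
def abortCall (p y : Prompt) (z : Val 0) (y' : Prompt) (h : Val 0) : Expr 0 :=
  .app (.app (.val (abortV p y z)) (.val (.prompt y'))) (.val h)

theorem abortCall_dets (p y : Prompt) (z : Val 0) (y' : Prompt) (h : Val 0) :
    Dets (abortCall p y z y' h) (ifE (eqE (.val (.prompt y)) (.val (.prompt y')))
      (.app (.val h) (.val z)) (.app (.val (raiseR p y)) (.val z))) := by
  refine .trans (Dets.appL (Dets.beta rfl) _) (Dets.beta ?_)
  generalize raiseR p y = r
  have h₁ : liftSub (Fin.cases h Val.var) (1 : Fin 2) = h.clo :=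
    liftSub_clo (i := 0) h.clo_zero.symm
  simp only [Expr.inst, Expr.subst, Val.subst, Val.rename, Expr.rename, ev, vr,
    ifE, eqE, letIn, seqE, Expr.up, trueV, falseV, Val.subst_clo, Val.rename_clo]
  congr
  all_goals exact (Val.rename_closed _ _).symm

theorem handlerR_dets (p y : Prompt) (h v : Val 0) : Dets (handlerR p y h (.val v)) (.val v) := by
  refine .trans (b := .app (.app (.reset (.prompt p) (.val (.lam (.val (.lam (.val v.clo))))))
    (.val (.prompt y))) (.val h.clo)) ?_ ?_
  · refine Dets.appL (Dets.appL (Dets.plug (.reset p .hole) (Dets.beta ?_)) _) _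
    have h₂ : liftSub (liftSub (Fin.cases v Val.var)) (2 : Fin 3) = v.clo :=
      liftSub_clo (i := 1) (liftSub_clo (i := 0) v.clo_zero.symm)
    simp only [Expr.inst, Expr.subst, Val.subst, ev, vr]
    congr
  · refine .trans (Dets.appL (.trans (Dets.appL (Contract.resetVal _ _).dets _)
      (Dets.beta (e₁ := .val (.lam (.val v.clo))) ?_)) _) (Dets.beta ?_)
    · simp only [Expr.inst, Expr.subst, Val.subst, Val.subst_clo]
    · exact inst_clo (.val v) _

theorem abortCall_dets_self (p y : Prompt) (z h : Val 0) :
    Dets (abortCall p y z y h) (.app (.val h) (.val z)) :=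
  (abortCall_dets p y z y h).trans <| .trans
    (Dets.ifE ((eqE_dets y y).trans (eqTest_dets_true y)) _ _)
    (ifE_dets_true _ _)

theorem abortCall_dets_ne {p y y' : Prompt} (hy : y ≠ y') (z h : Val 0) :
    Dets (abortCall p y z y' h) (grabR p y z) :=
  (abortCall_dets p y z y' h).trans <| .trans
    (Dets.ifE ((eqE_dets y y').trans (eqTest_dets_false hy)) _ _)
    ((ifE_dets_false _ _).trans (raiseR_dets p y z))

theorem handlerCtx_det {p : Prompt} (y y' : Prompt) (h z : Val 0) {E : ECtx 0}
    (hE : p ∉ E.surrounding) :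
    Det ((handlerCtx p y' h E).plug (grabR p y z)) (abortCall p y z y' h) := by
  have := Det.capture (.appL (.appL .hole (.val (.prompt y'))) (.val h.clo)) p (.appR constV E)
    (Expr.val (abortV p y z)).clo (by simpa using hE)
  rw [inst_clo] at this
  rw [abortCall, show Expr.val h = .val h.clo by rw [Val.clo_zero]]
  exact this

/-! ## Related terms -/

/-- A correspondence between the prompts of the two sides: `sync` relates the prompts known to
both programs and `handlers` the names of corresponding handlers; `raised` and `installed` give the
handlers used with a name by the first and by the second program. -/
structure World where
  sync : Prompt → Prompt → Prop
  handlers : Prompt → Prompt → Prop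
  raised : Prompt → Val 0 → Prop
  installed : Prompt → Val 0 → Prop

mutual

/-- Related expressions. -/
inductive ExprRel (p : Prompt) (W : World) : {n : ℕ} → Expr n → Expr n → Prop
  | val {n : ℕ} {v v' : Val n} (hv : ValRel p W v v') : ExprRel p W (.val v) (.val v')
  | app {n : ℕ} {e e' f f' : Expr n} (he : ExprRel p W e e') (hf : ExprRel p W f f') :
      ExprRel p W (.app e f) (.app e' f')
  | fresh {n : ℕ} {e e' : Expr (n + 1)} (he : ExprRel p W e e') :
      ExprRel p W (.fresh e) (.fresh e')
  | reset {n : ℕ} {v v' : Val n} {e e' : Expr n} (hv : ValRel p W v v') (he : ExprRel p W e e') :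
      ExprRel p W (.reset v e) (.reset v' e')
  | grab {n : ℕ} {v v' : Val n} {e e' : Expr (n + 1)} (hv : ValRel p W v v')
      (he : ExprRel p W e e') : ExprRel p W (.grab v e) (.grab v' e')
  | throw {n : ℕ} {v v' : Val n} {e e' : Expr n} (hv : ValRel p W v v') (he : ExprRel p W e e') :
      ExprRel p W (.throw v e) (.throw v' e')
  | body {n : ℕ} {f f' h h' : Val 0} {e e' : Expr n} (hf : ValRel p W f f') (hh : ValRel p W h h')
      (he : e = (bodyL f h).clo) (he' : e' = (bodyR p f' h').clo) : ExprRel p W e e'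
  | handler {n : ℕ} {x y : Prompt} {h : Val 0} {e e' : Expr n} (hx : W.handlers x y)
      (hh : W.installed x h) (he : ExprRel p W e e') :
      ExprRel p W (.reset (.prompt x) e) (handlerR p y h e')

/-- Related values. -/
inductive ValRel (p : Prompt) (W : World) : {n : ℕ} → Val n → Val n → Prop
  | var {n : ℕ} (i : Fin n) : ValRel p W (.var i) (.var i)
  | lam {n : ℕ} {e e' : Expr (n + 1)} (he : ExprRel p W e e') : ValRel p W (.lam e) (.lam e')
  | prompt {n : ℕ} {q q' : Prompt} (hq : W.sync q q') :
      ValRel p W (.prompt q : Val n) (.prompt q')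
  | cont {n : ℕ} {E E' : ECtx n} (hE : CtxRel p W E E') : ValRel p W (.cont E) (.cont E')
  | handle {n : ℕ} {v v' : Val n} (hv : v = handle.clo) (hv' : v' = (handleP p).clo) :
      ValRel p W v v'
  | partialApp {n : ℕ} {f f' : Val 0} {v v' : Val n} (hf : ValRel p W f f')
      (hv : v = (partialL f).clo) (hv' : v' = (partialR p f').clo) : ValRel p W v v'
  | raise {n : ℕ} {x y : Prompt} {h : Val 0} {v v' : Val n} (hx : W.handlers x y)
      (hh : W.raised x h) (hv : v = (raiseL x h).clo) (hv' : v' = (raiseR p y).clo) :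
      ValRel p W v v'

/-- Related evaluation contexts. -/
inductive CtxRel (p : Prompt) (W : World) : {n : ℕ} → ECtx n → ECtx n → Prop
  | hole {n : ℕ} : CtxRel p W (.hole : ECtx n) .hole
  | appL {n : ℕ} {E E' : ECtx n} {e e' : Expr n} (hE : CtxRel p W E E') (he : ExprRel p W e e') :
      CtxRel p W (.appL E e) (.appL E' e')
  | appR {n : ℕ} {v v' : Val n} {E E' : ECtx n} (hv : ValRel p W v v') (hE : CtxRel p W E E') :
      CtxRel p W (.appR v E) (.appR v' E')
  | reset {n : ℕ} {q q' : Prompt} {E E' : ECtx n} (hq : W.sync q q') (hE : CtxRel p W E E') :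
      CtxRel p W (.reset q E) (.reset q' E')
  | handler {n : ℕ} {x y : Prompt} {h : Val 0} {E E' : ECtx n} (hx : W.handlers x y)
      (hh : W.installed x h) (hE : CtxRel p W E E') :
      CtxRel p W (.reset x E) (handlerCtx p y h E')

end

variable {p : Prompt} {W : World}

theorem handlerR_rename {n m : ℕ} (ρ : Fin n → Fin m) (y : Prompt) (h : Val 0) (e : Expr n) :
    (handlerR p y h e).rename ρ = handlerR p y h (e.rename ρ) := by
  simp only [handlerR, Expr.rename, Val.rename, Val.rename_clo]
  rfl

theorem handlerR_subst {n m : ℕ} (σ : Fin n → Val m) (y : Prompt) (h : Val 0) (e : Expr n) :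
    (handlerR p y h e).subst σ = handlerR p y h (e.subst σ) := by
  simp only [handlerR, Expr.subst, Val.subst, Val.subst_clo]
  rfl

theorem handlerCtx_rename {n m : ℕ} (ρ : Fin n → Fin m) (y : Prompt) (h : Val 0) (E : ECtx n) :
    (handlerCtx p y h E).rename ρ = handlerCtx p y h (E.rename ρ) := by
  simp only [handlerCtx, ECtx.rename, Expr.rename, Val.rename, Val.rename_clo]
  rfl

theorem handlerCtx_subst {n m : ℕ} (σ : Fin n → Val m) (y : Prompt) (h : Val 0) (E : ECtx n) :
    (handlerCtx p y h E).subst σ = handlerCtx p y h (E.subst σ) := by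
  simp only [handlerCtx, ECtx.subst, Expr.subst, Val.subst, Val.subst_clo]
  rfl

mutual

theorem ExprRel.rename : ∀ {n m : ℕ} {e e' : Expr n} (ρ : Fin n → Fin m), ExprRel p W e e' →
    ExprRel p W (e.rename ρ) (e'.rename ρ)
  | _, _, _, _, ρ, .val hv => .val (hv.rename ρ)
  | _, _, _, _, ρ, .app he hf => .app (he.rename ρ) (hf.rename ρ)
  | _, _, _, _, ρ, .fresh he => .fresh (he.rename _)
  | _, _, _, _, ρ, .reset hv he => .reset (hv.rename ρ) (he.rename ρ)
  | _, _, _, _, ρ, .grab hv he => .grab (hv.rename ρ) (he.rename _)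
  | _, _, _, _, ρ, .throw hv he => .throw (hv.rename ρ) (he.rename ρ)
  | _, _, _, _, ρ, .body hf hh he he' =>
    .body hf hh (by rw [he, Expr.rename_clo]) (by rw [he', Expr.rename_clo])
  | _, _, _, _, ρ, .handler hx hh he => by
    rw [handlerR_rename]
    exact .handler hx hh (he.rename ρ)

theorem ValRel.rename : ∀ {n m : ℕ} {v v' : Val n} (ρ : Fin n → Fin m), ValRel p W v v' →
    ValRel p W (v.rename ρ) (v'.rename ρ)
  | _, _, _, _, _, .var i => .var _
  | _, _, _, _, ρ, .lam he => .lam (he.rename _)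
  | _, _, _, _, _, .prompt hq => .prompt hq
  | _, _, _, _, ρ, .cont hE => .cont (hE.rename ρ)
  | _, _, _, _, _, .handle hv hv' =>
    .handle (by rw [hv, Val.rename_clo]) (by rw [hv', Val.rename_clo])
  | _, _, _, _, _, .partialApp hf hv hv' =>
    .partialApp hf (by rw [hv, Val.rename_clo]) (by rw [hv', Val.rename_clo])
  | _, _, _, _, _, .raise hx hh hv hv' =>
    .raise hx hh (by rw [hv, Val.rename_clo]) (by rw [hv', Val.rename_clo])

theorem CtxRel.rename : ∀ {n m : ℕ} {E E' : ECtx n} (ρ : Fin n → Fin m), CtxRel p W E E' →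
    CtxRel p W (E.rename ρ) (E'.rename ρ)
  | _, _, _, _, _, .hole => .hole
  | _, _, _, _, ρ, .appL hE he => .appL (hE.rename ρ) (he.rename ρ)
  | _, _, _, _, ρ, .appR hv hE => .appR (hv.rename ρ) (hE.rename ρ)
  | _, _, _, _, ρ, .reset hq hE => .reset hq (hE.rename ρ)
  | _, _, _, _, ρ, .handler hx hh hE => by
    rw [handlerCtx_rename]
    exact .handler hx hh (hE.rename ρ)

end

theorem ValRel.liftSub {n m : ℕ} {σ σ' : Fin n → Val m} (h : ∀ i, ValRel p W (σ i) (σ' i))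
    (i : Fin (n + 1)) : ValRel p W (liftSub σ i) (DelimControl.liftSub σ' i) := by
  cases i using Fin.cases with
  | zero => exact .var 0
  | succ i => exact (h i).rename Fin.succ

mutual

theorem ExprRel.subst : ∀ {n m : ℕ} {e e' : Expr n} {σ σ' : Fin n → Val m},
    (∀ i, ValRel p W (σ i) (σ' i)) → ExprRel p W e e' → ExprRel p W (e.subst σ) (e'.subst σ')
  | _, _, _, _, _, _, hσ, .val hv => .val (hv.subst hσ)
  | _, _, _, _, _, _, hσ, .app he hf => .app (he.subst hσ) (hf.subst hσ)
  | _, _, _, _, _, _, hσ, .fresh he => .fresh (he.subst (.liftSub hσ))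
  | _, _, _, _, _, _, hσ, .reset hv he => .reset (hv.subst hσ) (he.subst hσ)
  | _, _, _, _, _, _, hσ, .grab hv he => .grab (hv.subst hσ) (he.subst (.liftSub hσ))
  | _, _, _, _, _, _, hσ, .throw hv he => .throw (hv.subst hσ) (he.subst hσ)
  | _, _, _, _, _, _, _, .body hf hh he he' =>
    .body hf hh (by rw [he, Expr.subst_clo]) (by rw [he', Expr.subst_clo])
  | _, _, _, _, _, _, hσ, .handler hx hh he => by
    rw [handlerR_subst]
    exact .handler hx hh (he.subst hσ)

theorem ValRel.subst : ∀ {n m : ℕ} {v v' : Val n} {σ σ' : Fin n → Val m},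
    (∀ i, ValRel p W (σ i) (σ' i)) → ValRel p W v v' → ValRel p W (v.subst σ) (v'.subst σ')
  | _, _, _, _, _, _, hσ, .var i => hσ i
  | _, _, _, _, _, _, hσ, .lam he => .lam (he.subst (.liftSub hσ))
  | _, _, _, _, _, _, _, .prompt hq => .prompt hq
  | _, _, _, _, _, _, hσ, .cont hE => .cont (hE.subst hσ)
  | _, _, _, _, _, _, _, .handle hv hv' =>
    .handle (by rw [hv, Val.subst_clo]) (by rw [hv', Val.subst_clo])
  | _, _, _, _, _, _, _, .partialApp hf hv hv' =>
    .partialApp hf (by rw [hv, Val.subst_clo]) (by rw [hv', Val.subst_clo])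
  | _, _, _, _, _, _, _, .raise hx hh hv hv' =>
    .raise hx hh (by rw [hv, Val.subst_clo]) (by rw [hv', Val.subst_clo])

theorem CtxRel.subst : ∀ {n m : ℕ} {E E' : ECtx n} {σ σ' : Fin n → Val m},
    (∀ i, ValRel p W (σ i) (σ' i)) → CtxRel p W E E' → CtxRel p W (E.subst σ) (E'.subst σ')
  | _, _, _, _, _, _, _, .hole => .hole
  | _, _, _, _, _, _, hσ, .appL hE he => .appL (hE.subst hσ) (he.subst hσ)
  | _, _, _, _, _, _, hσ, .appR hv hE => .appR (hv.subst hσ) (hE.subst hσ)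
  | _, _, _, _, _, _, hσ, .reset hq hE => .reset hq (hE.subst hσ)
  | _, _, _, _, _, _, hσ, .handler hx hh hE => by
    rw [handlerCtx_subst]
    exact .handler hx hh (hE.subst hσ)

end

theorem ExprRel.inst {e e' : Expr 1} {v v' : Val 0} (he : ExprRel p W e e')
    (hv : ValRel p W v v') : ExprRel p W (e.inst v) (e'.inst v') := by
  refine he.subst fun i => ?_
  cases i using Fin.cases with
  | zero => exact hv
  | succ i => exact i.elim0

theorem CtxRel.plug : ∀ {n : ℕ} {E E' : ECtx n} {e e' : Expr n}, CtxRel p W E E' →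
    ExprRel p W e e' → ExprRel p W (E.plug e) (E'.plug e')
  | _, _, _, _, _, .hole, he => he
  | _, _, _, _, _, .appL hE hf, he => .app (hE.plug he) hf
  | _, _, _, _, _, .appR hv hE, he => .app (.val hv) (hE.plug he)
  | _, _, _, _, _, .reset hq hE, he => .reset (.prompt hq) (hE.plug he)
  | _, _, _, _, _, .handler hx hh hE, he => .handler hx hh (hE.plug he)

theorem CtxRel.comp : ∀ {n : ℕ} {E E' F F' : ECtx n}, CtxRel p W E E' → CtxRel p W F F' →
    CtxRel p W (E.comp F) (E'.comp F')
  | _, _, _, _, _, .hole, hF => hF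
  | _, _, _, _, _, .appL hE hf, hF => .appL (hE.comp hF) hf
  | _, _, _, _, _, .appR hv hE, hF => .appR hv (hE.comp hF)
  | _, _, _, _, _, .reset hq hE, hF => .reset hq (hE.comp hF)
  | _, _, _, _, _, .handler hx hh hE, hF => .handler hx hh (hE.comp hF)

/-- `W'` has what `W` says about prompts in `S` on the one and `S'` on the other side. -/
structure World.LeOn (W : World) (S S' : Finset Prompt) (W' : World) : Prop where
  sync {a b : Prompt} : W.sync a b → a ∈ S → b ∈ S' → W'.sync a b
  handlers {x y : Prompt} : W.handlers x y → x ∈ S → y ∈ S' → W'.handlers x y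
  raised {x : Prompt} {h : Val 0} : W.raised x h → x ∈ S → h.prompts ⊆ S → W'.raised x h
  installed {x : Prompt} {h : Val 0} : W.installed x h → x ∈ S → h.prompts ⊆ S' →
    W'.installed x h

theorem prompts_bodyL (f h : Val 0) : (bodyL f h).prompts = f.prompts ∪ h.prompts := by
  simp [bodyL, Expr.prompts, Val.prompts, vr, ev]

theorem subset_prompts_bodyR (f h : Val 0) : f.prompts ∪ h.prompts ⊆ (bodyR p f h).prompts := by
  simp only [bodyR, Expr.prompts, Val.prompts, Val.prompts_clo]
  grind

theorem prompts_partialL (f : Val 0) : (partialL f).prompts = f.prompts := by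
  simp [partialL, Expr.prompts, Val.prompts, vr, ev]

theorem subset_prompts_partialR (f : Val 0) : f.prompts ⊆ (partialR p f).prompts := by
  simp only [partialR, Expr.prompts, Val.prompts, Val.prompts_clo]
  grind

theorem prompts_raiseL (x : Prompt) (h : Val 0) :
    (raiseL x h).prompts = {x} ∪ h.prompts := by
  simp [raiseL, Expr.prompts, Val.prompts, vr, ev]

theorem mem_prompts_raiseR (y : Prompt) : y ∈ (raiseR p y).prompts := by
  simp [raiseR, raise, fixV, fixAux, Expr.prompts, Val.prompts, vr, ev, ifE, eqE, letIn,
    Val.up, Expr.up, Val.rename, Expr.rename]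

theorem prompts_handlerR {n : ℕ} (y : Prompt) (h : Val 0) (e : Expr n) :
    (handlerR p y h e).prompts = {p} ∪ e.prompts ∪ {y} ∪ h.prompts := by
  simp [handlerR, Expr.prompts, Val.prompts, constV, vr, ev]

theorem prompts_handlerCtx {n : ℕ} (y : Prompt) (h : Val 0) (E : ECtx n) :
    (handlerCtx p y h E).prompts = {p} ∪ E.prompts ∪ {y} ∪ h.prompts := by
  simp [handlerCtx, ECtx.prompts, Expr.prompts, Val.prompts, constV, vr, ev]

section transport

variable {S S' : Finset Prompt} {W' : World}

mutual

theorem ExprRel.transport (hW : W.LeOn S S' W') : ∀ {n : ℕ} {e e' : Expr n}, ExprRel p W e e' →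
    e.prompts ⊆ S → e'.prompts ⊆ S' → ExprRel p W' e e'
  | _, _, _, .val hv, h, h' => .val (hv.transport hW h h')
  | _, _, _, .app he hf, h, h' => by
    simp only [Expr.prompts, Finset.union_subset_iff] at h h'
    exact .app (he.transport hW h.1 h'.1) (hf.transport hW h.2 h'.2)
  | _, _, _, .fresh he, h, h' => .fresh (he.transport hW h h')
  | _, _, _, .reset hv he, h, h' => by
    simp only [Expr.prompts, Finset.union_subset_iff] at h h'
    exact .reset (hv.transport hW h.1 h'.1) (he.transport hW h.2 h'.2)
  | _, _, _, .grab hv he, h, h' => by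
    simp only [Expr.prompts, Finset.union_subset_iff] at h h'
    exact .grab (hv.transport hW h.1 h'.1) (he.transport hW h.2 h'.2)
  | _, _, _, .throw hv he, h, h' => by
    simp only [Expr.prompts, Finset.union_subset_iff] at h h'
    exact .throw (hv.transport hW h.1 h'.1) (he.transport hW h.2 h'.2)
  | _, _, _, .body (f := f) (f' := f') (h := k) (h' := k') hf hh he he', h, h' => by
    rw [he, Expr.prompts_clo, prompts_bodyL, Finset.union_subset_iff] at h
    rw [he', Expr.prompts_clo] at h'
    replace h' := Finset.union_subset_iff.1 ((subset_prompts_bodyR _ _).trans h')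
    exact .body (hf.transport hW h.1 h'.1) (hh.transport hW h.2 h'.2) he he'
  | _, _, _, .handler hx hh he, h, h' => by
    simp only [Expr.prompts, Val.prompts, prompts_handlerR, Finset.union_subset_iff,
      Finset.singleton_subset_iff] at h h'
    exact .handler (hW.handlers hx h.1 h'.1.2) (hW.installed hh h.1 h'.2)
      (he.transport hW h.2 h'.1.1.2)

theorem ValRel.transport (hW : W.LeOn S S' W') : ∀ {n : ℕ} {v v' : Val n}, ValRel p W v v' →
    v.prompts ⊆ S → v'.prompts ⊆ S' → ValRel p W' v v'
  | _, _, _, .var i, _, _ => .var i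
  | _, _, _, .lam he, h, h' => .lam (he.transport hW h h')
  | _, _, _, .prompt hq, h, h' => by
    simp only [Val.prompts, Finset.singleton_subset_iff] at h h'
    exact .prompt (hW.sync hq h h')
  | _, _, _, .cont hE, h, h' => .cont (hE.transport hW h h')
  | _, _, _, .handle hv hv', _, _ => .handle hv hv'
  | _, _, _, .partialApp hf hv hv', h, h' => by
    rw [hv, Val.prompts_clo, prompts_partialL] at h
    rw [hv', Val.prompts_clo] at h'
    exact .partialApp (hf.transport hW h ((subset_prompts_partialR _).trans h')) hv hv'
  | _, _, _, .raise hx hh hv hv', h, h' => by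
    rw [hv, Val.prompts_clo, prompts_raiseL, Finset.union_subset_iff,
      Finset.singleton_subset_iff] at h
    rw [hv', Val.prompts_clo] at h'
    exact .raise (hW.handlers hx h.1 (h' (mem_prompts_raiseR _))) (hW.raised hh h.1 h.2) hv hv'

theorem CtxRel.transport (hW : W.LeOn S S' W') : ∀ {n : ℕ} {E E' : ECtx n}, CtxRel p W E E' →
    E.prompts ⊆ S → E'.prompts ⊆ S' → CtxRel p W' E E'
  | _, _, _, .hole, _, _ => .hole
  | _, _, _, .appL hE he, h, h' => by
    simp only [ECtx.prompts, Finset.union_subset_iff] at h h'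
    exact .appL (hE.transport hW h.1 h'.1) (he.transport hW h.2 h'.2)
  | _, _, _, .appR hv hE, h, h' => by
    simp only [ECtx.prompts, Finset.union_subset_iff] at h h'
    exact .appR (hv.transport hW h.1 h'.1) (hE.transport hW h.2 h'.2)
  | _, _, _, .reset hq hE, h, h' => by
    simp only [ECtx.prompts, Finset.union_subset_iff, Finset.singleton_subset_iff] at h h'
    exact .reset (hW.sync hq h.1 h'.1) (hE.transport hW h.2 h'.2)
  | _, _, _, .handler hx hh hE, h, h' => by
    simp only [ECtx.prompts, prompts_handlerCtx, Finset.union_subset_iff,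
      Finset.singleton_subset_iff] at h h'
    exact .handler (hW.handlers hx h.1 h'.1.2) (hW.installed hh h.1 h'.2)
      (hE.transport hW h.2 h'.1.1.2)

end

end transport

/-- The consistency conditions on a correspondence of prompts. -/
structure World.Good (p : Prompt) (W : World) : Prop where
  sync_right {a b b' : Prompt} : W.sync a b → W.sync a b' → b = b'
  sync_left {a a' b : Prompt} : W.sync a b → W.sync a' b → a = a'
  sync_ne {a b : Prompt} : W.sync a b → b ≠ p
  handlers_right {x y y' : Prompt} : W.handlers x y → W.handlers x y' → y = y'
  handlers_left {x x' y : Prompt} : W.handlers x y → W.handlers x' y → x = x'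
  disjoint {a b x y : Prompt} : W.sync a b → W.handlers x y → a ≠ x
  compatible {x : Prompt} {h h' : Val 0} : W.raised x h → W.installed x h' → ValRel p W h h'

/-! ## Surrounding prompts of related contexts -/

theorem mem_surrounding_handlerCtx {n : ℕ} {q y : Prompt} {h : Val 0} {E : ECtx n} :
    q ∈ (handlerCtx p y h E).surrounding ↔ q = p ∨ q ∈ E.surrounding := by
  simp [handlerCtx]

theorem CtxRel.mem_surrounding (hW : W.Good p) {q q' : Prompt} (hq : W.sync q q') :
    ∀ {n : ℕ} {E E' : ECtx n}, CtxRel p W E E' → (q ∈ E.surrounding ↔ q' ∈ E'.surrounding)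
  | _, _, _, .hole => by simp
  | _, _, _, .appL hE _ => by simpa using hE.mem_surrounding hW hq
  | _, _, _, .appR _ hE => by simpa using hE.mem_surrounding hW hq
  | _, _, _, .reset (q := a) (q' := a') ha hE => by
    have : q = a ↔ q' = a' := by
      constructor
      · rintro rfl
        exact hW.sync_right hq ha
      · rintro rfl
        exact hW.sync_left hq ha
    simp [this, hE.mem_surrounding hW hq]
  | _, _, _, .handler hx _ hE => by
    simp [mem_surrounding_handlerCtx, hE.mem_surrounding hW hq, hW.disjoint hq hx, hW.sync_ne hq]

theorem CtxRel.mem_surrounding_of_handlers (hW : W.Good p) {x y : Prompt} (hx : W.handlers x y) :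
    ∀ {n : ℕ} {E E' : ECtx n}, CtxRel p W E E' → x ∈ E.surrounding → p ∈ E'.surrounding
  | _, _, _, .hole, h => by simp at h
  | _, _, _, .appL hE _, h => by
    simpa using hE.mem_surrounding_of_handlers hW hx (by simpa using h)
  | _, _, _, .appR _ hE, h => by
    simpa using hE.mem_surrounding_of_handlers hW hx (by simpa using h)
  | _, _, _, .reset ha hE, h => by
    have := hE.mem_surrounding_of_handlers hW hx (by simpa [(hW.disjoint ha hx).symm] using h)
    simp [this]
  | _, _, _, .handler _ _ hE, h => by simp [mem_surrounding_handlerCtx]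

theorem CtxRel.split_left (hW : W.Good p) {q q' : Prompt} (hq : W.sync q q') {n : ℕ}
    {E₁ E₂ E' : ECtx n} (h : CtxRel p W (E₁.comp (.reset q E₂)) E') :
    ∃ E₁' E₂', E' = E₁'.comp (.reset q' E₂') ∧ CtxRel p W E₁ E₁' ∧ CtxRel p W E₂ E₂' := by
  match E₁ with
  | .hole =>
    cases h with
    | reset ha hE =>
      rw [hW.sync_right hq ha]
      exact ⟨.hole, _, rfl, .hole, hE⟩
    | handler hx _ hE => exact absurd rfl (hW.disjoint hq hx)
  | .appL E₁ e =>
    cases h with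
    | appL hE he =>
      obtain ⟨E₁', E₂', rfl, h₁, h₂⟩ := hE.split_left hW hq
      exact ⟨.appL E₁' _, E₂', rfl, .appL h₁ he, h₂⟩
  | .appR v E₁ =>
    cases h with
    | appR hv hE =>
      obtain ⟨E₁', E₂', rfl, h₁, h₂⟩ := hE.split_left hW hq
      exact ⟨.appR _ E₁', E₂', rfl, .appR hv h₁, h₂⟩
  | .reset a E₁ =>
    cases h with
    | reset ha hE =>
      obtain ⟨E₁', E₂', rfl, h₁, h₂⟩ := hE.split_left hW hq
      exact ⟨.reset _ E₁', E₂', rfl, .reset ha h₁, h₂⟩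
    | handler hx hh hE =>
      obtain ⟨E₁', E₂', rfl, h₁, h₂⟩ := hE.split_left hW hq
      exact ⟨handlerCtx p _ _ E₁', E₂', rfl, .handler hx hh h₁, h₂⟩

theorem CtxRel.split_right (hW : W.Good p) {q q' : Prompt} (hq : W.sync q q') :
    ∀ {n : ℕ} {E E' : ECtx n}, CtxRel p W E E' → ∀ {E₁' E₂'}, E' = E₁'.comp (.reset q' E₂') →
    ∃ E₁ E₂, E = E₁.comp (.reset q E₂) ∧ CtxRel p W E₁ E₁' ∧ CtxRel p W E₂ E₂'
  | _, _, _, .hole, E₁', E₂', h => by cases E₁' <;> simp [ECtx.comp] at h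
  | _, _, _, .appL hE he, E₁', E₂', h => by
    cases E₁' <;> simp only [ECtx.comp, reduceCtorEq, ECtx.appL.injEq] at h
    obtain ⟨h, rfl⟩ := h
    obtain ⟨E₁, E₂, rfl, h₁, h₂⟩ := hE.split_right hW hq h
    exact ⟨.appL E₁ _, E₂, rfl, .appL h₁ he, h₂⟩
  | _, _, _, .appR hv hE, E₁', E₂', h => by
    cases E₁' <;> simp only [ECtx.comp, reduceCtorEq, ECtx.appR.injEq] at h
    obtain ⟨rfl, h⟩ := h
    obtain ⟨E₁, E₂, rfl, h₁, h₂⟩ := hE.split_right hW hq h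
    exact ⟨.appR _ E₁, E₂, rfl, .appR hv h₁, h₂⟩
  | _, _, _, .reset ha hE, E₁', E₂', h => by
    cases E₁' <;> simp only [ECtx.comp, reduceCtorEq, ECtx.reset.injEq] at h
    · obtain ⟨rfl, rfl⟩ := h
      rw [← hW.sync_left hq ha] at *
      exact ⟨.hole, _, rfl, .hole, hE⟩
    · obtain ⟨rfl, h⟩ := h
      obtain ⟨E₁, E₂, rfl, h₁, h₂⟩ := hE.split_right hW hq h
      exact ⟨.reset _ E₁, E₂, rfl, .reset ha h₁, h₂⟩
  | _, _, _, .handler (x := x) hx hh hE, E₁', E₂', h => by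
    rcases E₁' with _ | ⟨_ | ⟨_ | _ | _ | ⟨_, _ | _ | ⟨_, E₁'⟩⟩, _⟩, _⟩ <;>
      simp only [handlerCtx, ECtx.comp, reduceCtorEq, ECtx.appL.injEq, ECtx.reset.injEq,
        ECtx.appR.injEq, false_and, and_false] at h
    · exact absurd h.1.1.1.symm (hW.sync_ne hq)
    · obtain ⟨⟨⟨rfl, rfl, h⟩, rfl⟩, rfl⟩ := h
      obtain ⟨E₁, E₂, rfl, h₁, h₂⟩ := hE.split_right hW hq h
      exact ⟨.reset x E₁, E₂, rfl, .handler hx hh h₁, h₂⟩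

/-- The innermost handler around the hole of related contexts. -/
theorem CtxRel.innermost_handler (hW : W.Good p) : ∀ {n : ℕ} {E E' : ECtx n}, CtxRel p W E E' →
    p ∉ E'.surrounding ∨ ∃ E₁ E₁' E₂ E₂' x y h, E = E₁.comp (.reset x E₂) ∧
      E' = E₁'.comp (handlerCtx p y h E₂') ∧ CtxRel p W E₁ E₁' ∧ CtxRel p W E₂ E₂' ∧
      W.handlers x y ∧ W.installed x h ∧ p ∉ E₂'.surrounding
  | _, _, _, .hole => .inl (by simp)
  | _, _, _, .appL hE he => by
    rcases hE.innermost_handler hW with h | ⟨E₁, E₁', E₂, E₂', x, y, h, rfl, rfl, h₁, h⟩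
    · exact .inl (by simpa using h)
    · exact .inr ⟨.appL E₁ _, .appL E₁' _, E₂, E₂', x, y, _, rfl, rfl, .appL h₁ he, h⟩
  | _, _, _, .appR hv hE => by
    rcases hE.innermost_handler hW with h | ⟨E₁, E₁', E₂, E₂', x, y, h, rfl, rfl, h₁, h⟩
    · exact .inl (by simpa using h)
    · exact .inr ⟨.appR _ E₁, .appR _ E₁', E₂, E₂', x, y, _, rfl, rfl, .appR hv h₁, h⟩
  | _, _, _, .reset hq hE => by
    rcases hE.innermost_handler hW with h | ⟨E₁, E₁', E₂, E₂', x, y, h, rfl, rfl, h₁, h⟩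
    · exact .inl (by simpa [(hW.sync_ne hq).symm] using h)
    · exact .inr ⟨.reset _ E₁, .reset _ E₁', E₂, E₂', x, y, _, rfl, rfl, .reset hq h₁, h⟩
  | _, _, _, .handler hx hh hE => by
    rcases hE.innermost_handler hW with h | ⟨E₁, E₁', E₂, E₂', x, y, h, rfl, rfl, h₁, h⟩
    · exact .inr ⟨.hole, .hole, _, _, _, _, _, rfl, rfl, .hole, hE, hx, hh, h⟩
    · exact .inr ⟨.reset _ E₁, handlerCtx p _ _ E₁', E₂, E₂', x, y, _, rfl, rfl,
        .handler hx hh h₁, h⟩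

/-! ## Filling multi-hole contexts with related values -/

/-- Related environments. -/
abbrev EnvRel (p : Prompt) (W : World) : List (Val 0) → List (Val 0) → Prop :=
  List.Forall₂ (ValRel p W)

theorem optionRel_bind {α β γ δ : Type} {r : α → β → Prop} {s : γ → δ → Prop} {a : Option α}
    {b : Option β} {f : α → Option γ} {g : β → Option δ} (h : Option.Rel r a b)
    (hf : ∀ x y, r x y → Option.Rel s (f x) (g y)) : Option.Rel s (a >>= f) (b >>= g) := by
  cases h with
  | some h => exact hf _ _ h
  | none => exact .none

theorem EnvRel.getElem? {Γ Γ' : List (Val 0)} (h : EnvRel p W Γ Γ') (i : ℕ) :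
    Option.Rel (ValRel p W) Γ[i]? Γ'[i]? := by
  induction h generalizing i with
  | nil => exact .none
  | cons h _ ih =>
    cases i with
    | zero => exact .some h
    | succ i => simpa using ih i

theorem ValRel.toCont? {n : ℕ} {v v' : Val n} (h : ValRel p W v v') :
    Option.Rel (CtxRel p W) v.toCont? v'.toCont? := by
  cases h with
  | cont hE => exact .some hE
  | handle hv hv' => subst hv hv'; exact .none
  | partialApp hf hv hv' => subst hv hv'; exact .none
  | raise hx hh hv hv' => subst hv hv'; exact .none
  | _ => exact .none

theorem ValRel.toPrompt? {n : ℕ} {v v' : Val n} (h : ValRel p W v v') :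
    Option.Rel W.sync v.toPrompt? v'.toPrompt? := by
  cases h with
  | prompt hq => exact .some hq
  | handle hv hv' => subst hv hv'; exact .none
  | partialApp hf hv hv' => subst hv hv'; exact .none
  | raise hx hh hv hv' => subst hv hv'; exact .none
  | _ => exact .none

mutual

theorem EnvRel.fill {Γ Γ' : List (Val 0)} (h : EnvRel p W Γ Γ') : ∀ {n : ℕ} (M : MCtx n),
    Option.Rel (ExprRel p W) (M.fill Γ) (M.fill Γ')
  | _, .val V => optionRel_bind (h.fillVal V) fun _ _ hv => .some (.val hv)
  | _, .app M₁ M₂ => optionRel_bind (h.fill M₁) fun _ _ h₁ =>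
    optionRel_bind (h.fill M₂) fun _ _ h₂ => .some (.app h₁ h₂)
  | _, .fresh M => optionRel_bind (h.fill M) fun _ _ h₁ => .some (.fresh h₁)
  | _, .reset V M => optionRel_bind (h.fillVal V) fun _ _ hv =>
    optionRel_bind (h.fill M) fun _ _ h₁ => .some (.reset hv h₁)
  | _, .grab V M => optionRel_bind (h.fillVal V) fun _ _ hv =>
    optionRel_bind (h.fill M) fun _ _ h₁ => .some (.grab hv h₁)
  | _, .throw V M => optionRel_bind (h.fillVal V) fun _ _ hv =>
    optionRel_bind (h.fill M) fun _ _ h₁ => .some (.throw hv h₁)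
  | _, .star i M => optionRel_bind (h.getElem? i) fun _ _ hw =>
    optionRel_bind hw.toCont? fun _ _ hE => optionRel_bind (h.fill M) fun _ _ h₁ =>
      .some ((hE.rename _).plug h₁)

theorem EnvRel.fillVal {Γ Γ' : List (Val 0)} (h : EnvRel p W Γ Γ') : ∀ {n : ℕ} (V : MVal n),
    Option.Rel (ValRel p W) (V.fill Γ) (V.fill Γ')
  | _, .var i => .some (.var i)
  | _, .lam M => optionRel_bind (h.fill M) fun _ _ h₁ => .some (.lam h₁)
  | _, .cont F => optionRel_bind (h.fillCtx F) fun _ _ hE => .some (.cont hE)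
  | _, .hole i => optionRel_bind (h.getElem? i) fun _ _ hw => .some (hw.rename _)

theorem EnvRel.fillCtx {Γ Γ' : List (Val 0)} (h : EnvRel p W Γ Γ') : ∀ {n : ℕ} (F : MECtx n),
    Option.Rel (CtxRel p W) (F.fill Γ) (F.fill Γ')
  | _, .evalHole => .some .hole
  | _, .appL F M => optionRel_bind (h.fillCtx F) fun _ _ hE =>
    optionRel_bind (h.fill M) fun _ _ h₁ => .some (.appL hE h₁)
  | _, .appR V F => optionRel_bind (h.fillVal V) fun _ _ hv =>
    optionRel_bind (h.fillCtx F) fun _ _ hE => .some (.appR hv hE)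
  | _, .reset i F => optionRel_bind (h.getElem? i) fun _ _ hw =>
    optionRel_bind hw.toPrompt? fun _ _ hq => optionRel_bind (h.fillCtx F) fun _ _ hE =>
      .some (.reset hq hE)
  | _, .star i F => optionRel_bind (h.getElem? i) fun _ _ hw =>
    optionRel_bind hw.toCont? fun _ _ hE' => optionRel_bind (h.fillCtx F) fun _ _ hE =>
      .some ((hE'.rename _).comp hE)

end

/-! ## Simulation of reductions -/

/-- Expressions in corresponding phases of evaluation: they are related, or they both raise the
same exception, and the second program may have aborted more of the evaluation context. -/
inductive Core (p : Prompt) (W : World) : Expr 0 → Expr 0 → Prop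
  | rel {e e' : Expr 0} (h : ExprRel p W e e') : Core p W e e'
  | raised {E E' F : ECtx 0} {x y : Prompt} {h z z' : Val 0} (hE : CtxRel p W E E')
      (hx : W.handlers x y) (hh : W.raised x h) (hz : ValRel p W z z') (hF : x ∉ F.surrounding) :
      Core p W ((E.comp F).plug (grabL x h z)) (E'.plug (grabR p y z'))

theorem Core.plug {F F' : ECtx 0} (hF : CtxRel p W F F') {e e' : Expr 0} (h : Core p W e e') :
    Core p W (F.plug e) (F'.plug e') := by
  cases h with
  | rel h => exact .rel (hF.plug h)
  | raised hE hx hh hz hF' =>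
    rw [← ECtx.plug_comp, ← ECtx.plug_comp, ← ECtx.comp_assoc]
    exact .raised (hF.comp hE) hx hh hz hF'

/-- Related expressions that are not decomposed further by evaluation contexts. -/
inductive RedexRel (p : Prompt) (W : World) : Expr 0 → Expr 0 → Prop
  | app {v v' w w' : Val 0} (hv : ValRel p W v v') (hw : ValRel p W w w') :
      RedexRel p W (.app (.val v) (.val w)) (.app (.val v') (.val w'))
  | resetVal {q q' : Prompt} {v v' : Val 0} (hq : W.sync q q') (hv : ValRel p W v v') :
      RedexRel p W (.reset (.prompt q) (.val v)) (.reset (.prompt q') (.val v'))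
  | resetBad {v v' : Val 0} {e e' : Expr 0} (hv : ∀ q, v ≠ .prompt q)
      (hv' : ∀ q, v' ≠ .prompt q) : RedexRel p W (.reset v e) (.reset v' e')
  | handlerVal {x y : Prompt} {h v v' : Val 0} (hv : ValRel p W v v') :
      RedexRel p W (.reset (.prompt x) (.val v)) (handlerR p y h (.val v'))
  | fresh {e e' : Expr 1} (he : ExprRel p W e e') : RedexRel p W (.fresh e) (.fresh e')
  | body {f f' h h' : Val 0} (hf : ValRel p W f f') (hh : ValRel p W h h') :
      RedexRel p W (bodyL f h) (bodyR p f' h')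
  | grab {v v' : Val 0} {e e' : Expr 1} (hv : ValRel p W v v') (he : ExprRel p W e e') :
      RedexRel p W (.grab v e) (.grab v' e')
  | throw {v v' : Val 0} {e e' : Expr 0} (hv : ValRel p W v v') (he : ExprRel p W e e') :
      RedexRel p W (.throw v e) (.throw v' e')

/-- Application to related values leads to corresponding phases. -/
def BodyRel (p : Prompt) (W : World) (e e' : Expr 1) : Prop :=
  ∀ v v', ValRel p W v v' → ∃ e₂', Dets (e'.inst v') e₂' ∧ Core p W (e.inst v) e₂'

theorem Contract.inst_eq {e : Expr 1} {v : Val 0} {r : Expr 0}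
    (h : Contract (.app (.val (.lam e)) (.val v)) r) : e.inst v = r :=
  (Contract.beta e v).unique h

/-- The possible shapes of related closed values. -/
theorem ValRel.shape {v v' : Val 0} (h : ValRel p W v v') :
    (∃ e e', v = .lam e ∧ v' = .lam e' ∧ BodyRel p W e e') ∨
    (∃ q q', v = .prompt q ∧ v' = .prompt q' ∧ W.sync q q') ∨
    ∃ E E', v = .cont E ∧ v' = .cont E' ∧ CtxRel p W E E' := by
  cases h with
  | var i => exact i.elim0
  | lam he => exact .inl ⟨_, _, rfl, rfl, fun v v' hv => ⟨_, .refl, .rel (he.inst hv)⟩⟩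
  | prompt hq => exact .inr (.inl ⟨_, _, rfl, rfl, hq⟩)
  | cont hE => exact .inr (.inr ⟨_, _, rfl, rfl, hE⟩)
  | handle hv hv' =>
    rw [Val.clo_zero] at hv hv'
    refine .inl ⟨_, _, hv, hv', fun v v' h => ⟨_, .refl, .rel ?_⟩⟩
    rw [(Contract.handle v).inst_eq, (Contract.handleP p v').inst_eq]
    exact .val (.partialApp h (Val.clo_zero _).symm (Val.clo_zero _).symm)
  | partialApp hf hv hv' =>
    rw [Val.clo_zero] at hv hv'
    refine .inl ⟨_, _, hv, hv', fun v v' h => ⟨_, .refl, .rel ?_⟩⟩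
    rw [(Contract.partialL _ v).inst_eq, (Contract.partialR p _ v').inst_eq]
    exact .body hf h (Expr.clo_zero _).symm (Expr.clo_zero _).symm
  | raise hx hh hv hv' =>
    rw [Val.clo_zero] at hv hv'
    refine .inl ⟨_, _, hv, hv'.trans (raiseR_eq _ _), fun v v' h => ⟨_, raiseBody_dets _ _ _, ?_⟩⟩
    rw [(Contract.raiseL _ _ v).inst_eq]
    exact .raised (F := .hole) .hole hx hh h (by simp)

theorem ExprRel.decompose {e e' : Expr 0} (h : ExprRel p W e e') :
    (∃ v v', e = .val v ∧ e' = .val v' ∧ ValRel p W v v') ∨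
    ∃ E E' r r', CtxRel p W E E' ∧ RedexRel p W r r' ∧ e = E.plug r ∧ e' = E'.plug r' := by
  cases h with
  | val hv => exact .inl ⟨_, _, rfl, rfl, hv⟩
  | app he hf =>
    rcases he.decompose with ⟨v, v', rfl, rfl, hv⟩ | ⟨E, E', r, r', hE, hr, rfl, rfl⟩
    · rcases hf.decompose with ⟨w, w', rfl, rfl, hw⟩ | ⟨E, E', r, r', hE, hr, rfl, rfl⟩
      · exact .inr ⟨_, _, _, _, .hole, .app hv hw, rfl, rfl⟩
      · exact .inr ⟨_, _, _, _, .appR hv hE, hr, rfl, rfl⟩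
    · exact .inr ⟨_, _, _, _, .appL hE hf, hr, rfl, rfl⟩
  | fresh he => exact .inr ⟨_, _, _, _, .hole, .fresh he, rfl, rfl⟩
  | reset hv he =>
    rcases hv.shape with ⟨e, e', rfl, rfl, -⟩ | ⟨q, q', rfl, rfl, hq⟩ | ⟨E, E', rfl, rfl, -⟩
    · exact .inr ⟨_, _, _, _, .hole, .resetBad (by simp) (by simp), rfl, rfl⟩
    · rcases he.decompose with ⟨v, v', rfl, rfl, hv⟩ | ⟨E, E', r, r', hE, hr, rfl, rfl⟩
      · exact .inr ⟨_, _, _, _, .hole, .resetVal hq hv, rfl, rfl⟩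
      · exact .inr ⟨_, _, _, _, .reset hq hE, hr, rfl, rfl⟩
    · exact .inr ⟨_, _, _, _, .hole, .resetBad (by simp) (by simp), rfl, rfl⟩
  | grab hv he => exact .inr ⟨_, _, _, _, .hole, .grab hv he, rfl, rfl⟩
  | throw hv he => exact .inr ⟨_, _, _, _, .hole, .throw hv he, rfl, rfl⟩
  | body hf hh he he' =>
    rw [Expr.clo_zero] at he he'
    exact .inr ⟨_, _, _, _, .hole, .body hf hh, he, he'⟩
  | handler hx hh he =>
    rcases he.decompose with ⟨v, v', rfl, rfl, hv⟩ | ⟨E, E', r, r', hE, hr, rfl, rfl⟩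
    · exact .inr ⟨_, _, _, _, .hole, .handlerVal hv, rfl, rfl⟩
    · exact .inr ⟨_, _, _, _, .handler hx hh hE, hr, rfl, rfl⟩
termination_by e

/-- Expressions without transitions. -/
structure Dead (e : Expr 0) : Prop where
  not_isValue : ¬ e.IsValue
  not_red (e₁ : Expr 0) : ¬ Red e e₁
  not_grab (E : ECtx 0) (q : Prompt) (b : Expr 1) : e ≠ E.plug (.grab (.prompt q) b)

theorem PotRedex.dead {r : Expr 0} (hr : PotRedex r) (hc : ∀ r₁, ¬ Contract r r₁)
    (hf : ∀ b, r ≠ .fresh b) (hg : ∀ q b, r ≠ .grab (.prompt q) b) (E : ECtx 0) :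
    Dead (E.plug r) where
  not_isValue := fun ⟨v, hv⟩ => hr.plug_ne_val E v hv
  not_red e₁ h := by
    rcases h.potRedex hr rfl with ⟨r₁, h⟩ | ⟨b, h⟩ | ⟨q, b, h, -⟩
    · exact hc _ h
    · exact hf _ h
    · exact hg _ _ h
  not_grab F q b h := hg q b (plug_unique hr (.grab _ _) h).2

theorem not_red_of_stuck {E : ECtx 0} {q : Prompt} {b : Expr 1} (hq : q ∉ E.surrounding)
    (e₁ : Expr 0) : ¬ Red (E.plug (.grab (.prompt q) b)) e₁ := by
  intro h
  rcases h.potRedex (.grab _ _) rfl with ⟨r₁, h⟩ | ⟨b, h⟩ | ⟨q, b, h, h'⟩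
  · cases h
  · cases h
  · cases h
    exact hq h'

/-- The ways in which two expressions in corresponding phases may go on. -/
inductive Outcome (p : Prompt) (W : World) : Expr 0 → Expr 0 → Prop
  | value {v v' : Val 0} (hv : ValRel p W v v') : Outcome p W (.val v) (.val v')
  | dead {e e' : Expr 0} (he : Dead e) (he' : Dead e') : Outcome p W e e'
  | stuck {E E' : ECtx 0} {q q' : Prompt} {b b' : Expr 1} (hq : q ∉ E.surrounding)
      (hq' : q' ∉ E'.surrounding) :
      Outcome p W (E.plug (.grab (.prompt q) b)) (E'.plug (.grab (.prompt q') b'))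
  | det {e e' e₁ e₁' e₂' : Expr 0} (h : Det e e₁) (h' : Det e' e₁') (h₁ : Dets e₁' e₂')
      (h₂ : Core p W e₁ e₂') : Outcome p W e e'
  | fresh {E E' : ECtx 0} {b b' : Expr 1} (hE : CtxRel p W E E') (hb : ExprRel p W b b') :
      Outcome p W (E.plug (.fresh b)) (E'.plug (.fresh b'))
  | body {E E' : ECtx 0} {f f' h h' : Val 0} (hE : CtxRel p W E E') (hf : ValRel p W f f')
      (hh : ValRel p W h h') : Outcome p W (E.plug (bodyL f h)) (E'.plug (bodyR p f' h'))

theorem Outcome.contract {E E' : ECtx 0} (hE : CtxRel p W E E') {r r' r₁ r₁' r₂' : Expr 0}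
    (h : Contract r r₁) (h' : Contract r' r₁') (h₁ : Dets r₁' r₂') (h₂ : Core p W r₁ r₂') :
    Outcome p W (E.plug r) (E'.plug r') :=
  .det (.contract E h) (.contract E' h') (h₁.plug E') (h₂.plug hE)

theorem Outcome.deadRedex {E E' : ECtx 0} {r r' : Expr 0} (hr : PotRedex r)
    (hc : ∀ r₁, ¬ Contract r r₁) (hf : ∀ b, r ≠ .fresh b) (hg : ∀ q b, r ≠ .grab (.prompt q) b)
    (hr' : PotRedex r') (hc' : ∀ r₁, ¬ Contract r' r₁) (hf' : ∀ b, r' ≠ .fresh b)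
    (hg' : ∀ q b, r' ≠ .grab (.prompt q) b) : Outcome p W (E.plug r) (E'.plug r') :=
  .dead (hr.dead hc hf hg E) (hr'.dead hc' hf' hg' E')

theorem RedexRel.outcome (hW : W.Good p) {E E' : ECtx 0} {r r' : Expr 0} (hE : CtxRel p W E E')
    (hr : RedexRel p W r r') : Outcome p W (E.plug r) (E'.plug r') := by
  cases hr with
  | app hv hw =>
    rcases hv.shape with ⟨e, e', rfl, rfl, h⟩ | ⟨q, q', rfl, rfl, hq⟩ | ⟨F, F', rfl, rfl, -⟩
    · obtain ⟨e₂', h₁, h₂⟩ := h _ _ hw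
      exact .contract hE (.beta _ _) (.beta _ _) h₁ h₂
    · exact .deadRedex (.app _ _) (by rintro _ ⟨⟩) (by simp) (by simp)
        (.app _ _) (by rintro _ ⟨⟩) (by simp) (by simp)
    · exact .deadRedex (.app _ _) (by rintro _ ⟨⟩) (by simp) (by simp)
        (.app _ _) (by rintro _ ⟨⟩) (by simp) (by simp)
  | resetVal hq hv => exact .contract hE (.resetVal _ _) (.resetVal _ _) .refl (.rel (.val hv))
  | resetBad hv hv' =>
    exact .deadRedex (.resetBad _ _ hv) (by rintro _ ⟨⟩; exact hv _ rfl) (by simp) (by simp)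
      (.resetBad _ _ hv') (by rintro _ ⟨⟩; exact hv' _ rfl) (by simp) (by simp)
  | handlerVal hv =>
    rename_i x y h v v'
    rcases (handlerR_dets p y h v').cases_head with h' | ⟨e₁', h₁, h₂⟩
    · cases h'
    · exact .det (.contract E (.resetVal _ _)) (h₁.plug E') (Dets.plug E' h₂)
        ((Core.rel (.val hv)).plug hE)
  | fresh he => exact .fresh hE he
  | body hf hh => exact .body hE hf hh
  | grab hv he =>
    rcases hv.shape with ⟨e, e', rfl, rfl, -⟩ | ⟨q, q', rfl, rfl, hq⟩ | ⟨F, F', rfl, rfl, -⟩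
    · exact .deadRedex (.grab _ _) (by rintro _ ⟨⟩) (by simp) (by simp)
        (.grab _ _) (by rintro _ ⟨⟩) (by simp) (by simp)
    · by_cases h : q ∈ E.surrounding
      · obtain ⟨E₁, E₂, rfl, h₂⟩ := ECtx.exists_innermost h
        obtain ⟨E₁', E₂', rfl, hE₁, hE₂⟩ := hE.split_left hW hq
        exact .det (.capture _ _ _ _ h₂)
          (.capture _ _ _ _ ((hE₂.mem_surrounding hW hq).not.1 h₂)) .refl
          ((Core.rel (he.inst (.cont hE₂))).plug hE₁)
      · exact .stuck h ((hE.mem_surrounding hW hq).not.1 h)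
    · exact .deadRedex (.grab _ _) (by rintro _ ⟨⟩) (by simp) (by simp)
        (.grab _ _) (by rintro _ ⟨⟩) (by simp) (by simp)
  | throw hv he =>
    rcases hv.shape with ⟨e, e', rfl, rfl, -⟩ | ⟨q, q', rfl, rfl, hq⟩ | ⟨F, F', rfl, rfl, hF⟩
    · exact .deadRedex (.throw _ _) (by rintro _ ⟨⟩) (by simp) (by simp)
        (.throw _ _) (by rintro _ ⟨⟩) (by simp) (by simp)
    · exact .deadRedex (.throw _ _) (by rintro _ ⟨⟩) (by simp) (by simp)
        (.throw _ _) (by rintro _ ⟨⟩) (by simp) (by simp)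
    · exact .contract hE (.throw _ _) (.throw _ _) .refl (.rel (hF.plug he))

/-- The number of layers of an evaluation context. -/
def ECtx.depth {n : ℕ} : ECtx n → ℕ
  | .hole => 0
  | .appL E _ => E.depth + 1
  | .appR _ E => E.depth + 1
  | .reset _ E => E.depth + 1

theorem ECtx.depth_comp {n : ℕ} (E F : ECtx n) : (E.comp F).depth = E.depth + F.depth := by
  match E with
  | .hole => simp [ECtx.comp, ECtx.depth]
  | .appL E _ => simp [ECtx.comp, ECtx.depth, E.depth_comp]; omega
  | .appR _ E => simp [ECtx.comp, ECtx.depth, E.depth_comp]; omega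
  | .reset _ E => simp [ECtx.comp, ECtx.depth, E.depth_comp]; omega

theorem Core.raised_outcome (hW : W.Good p) {E E' F : ECtx 0} {x y : Prompt} {h z z' : Val 0}
    (hE : CtxRel p W E E') (hx : W.handlers x y) (hh : W.raised x h) (hz : ValRel p W z z')
    (hF : x ∉ F.surrounding) : ∃ e₂', Dets (E'.plug (grabR p y z')) e₂' ∧
      Core p W ((E.comp F).plug (grabL x h z)) e₂' ∧
      Outcome p W ((E.comp F).plug (grabL x h z)) e₂' := by
  rcases hE.innermost_handler hW with hp | ⟨E₁, E₁', E₂, E₂', x₂, y₂, h₂, rfl, rfl, h₁, hE₂, hx₂,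
    hh₂, hp⟩
  · refine ⟨_, .refl, .raised hE hx hh hz hF, .stuck ?_ hp⟩
    rw [ECtx.mem_surrounding_comp, not_or]
    exact ⟨fun hx' => hp (hE.mem_surrounding_of_handlers hW hx hx'), hF⟩
  have hE₂x : x ∉ E₂.surrounding := fun hx' => hp (hE₂.mem_surrounding_of_handlers hW hx hx')
  have hdet := (handlerCtx_det y y₂ h₂ z' hp).plug E₁'
  rw [← ECtx.plug_comp] at hdet
  by_cases hxx : x₂ = x
  · subst hxx
    obtain rfl := hW.handlers_right hx hx₂
    refine ⟨_, .refl, .raised hE hx hh hz hF, ?_⟩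
    rw [ECtx.comp_assoc]
    refine .det (e₁ := E₁.plug (.app (.val h) (.val z)))
      (e₂' := E₁'.plug (.app (.val h₂) (.val z'))) ?_ hdet
      ((abortCall_dets_self p y z' h₂).plug E₁')
      (.rel (h₁.plug (.app (.val (hW.compatible hh hh₂)) (.val hz))))
    rw [← inst_grabL h z (.cont (E₂.comp F))]
    exact .capture _ _ _ _ (by simp [hE₂x, hF])
  · have hyy : y ≠ y₂ := fun h => hxx (hW.handlers_left hx₂ (h ▸ hx))
    obtain ⟨e₂', hd, hc, ho⟩ := Core.raised_outcome hW (F := (ECtx.reset x₂ E₂).comp F)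
      h₁ hx hh hz (by simp [hE₂x, hF, Ne.symm hxx])
    rw [← ECtx.comp_assoc] at hc ho
    exact ⟨e₂', .head hdet (((abortCall_dets_ne hyy z' h₂).plug E₁').trans hd), hc, ho⟩
termination_by E.depth
decreasing_by
  subst_vars
  simp [ECtx.depth_comp, ECtx.depth]

/-- After finitely many deterministic reductions of the second expression, the two expressions can
go on in the same way. -/
theorem Core.outcome (hW : W.Good p) {e e' : Expr 0} (h : Core p W e e') :
    ∃ e₂', Dets e' e₂' ∧ Core p W e e₂' ∧ Outcome p W e e₂' := by
  cases h with
  | rel h =>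
    refine ⟨e', .refl, .rel h, ?_⟩
    rcases h.decompose with ⟨v, v', rfl, rfl, hv⟩ | ⟨E, E', r, r', hE, hr, rfl, rfl⟩
    · exact .value hv
    · exact hr.outcome hW hE
  | raised hE hx hh hz hF => exact Core.raised_outcome hW hE hx hh hz hF

/-! ## Extending a correspondence by fresh prompts -/

/-- The restriction of a correspondence to given prompts. -/
def World.restrict (W : World) (S S' : Finset Prompt) : World where
  sync a b := W.sync a b ∧ a ∈ S ∧ b ∈ S'
  handlers x y := W.handlers x y ∧ x ∈ S ∧ y ∈ S'
  raised x h := W.raised x h ∧ x ∈ S ∧ h.prompts ⊆ S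
  installed x h := W.installed x h ∧ x ∈ S ∧ h.prompts ⊆ S'

/-- The addition of a pair of prompts. -/
def World.addSync (W : World) (a b : Prompt) : World :=
  { W with sync := fun c d => W.sync c d ∨ c = a ∧ d = b }

/-- The addition of a pair of handlers. -/
def World.addHandler (W : World) (x y : Prompt) (h h' : Val 0) : World :=
  { W with
    handlers := fun c d => W.handlers c d ∨ c = x ∧ d = y
    raised := fun c k => W.raised c k ∨ c = x ∧ k = h
    installed := fun c k => W.installed c k ∨ c = x ∧ k = h' }

variable {S S' : Finset Prompt}

theorem World.leOn_addSync (a b : Prompt) : W.LeOn S S' ((W.restrict S S').addSync a b) :=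
  ⟨fun h ha hb => .inl ⟨h, ha, hb⟩, fun h ha hb => ⟨h, ha, hb⟩, fun h ha hb => ⟨h, ha, hb⟩,
    fun h ha hb => ⟨h, ha, hb⟩⟩

theorem World.leOn_addHandler (x y : Prompt) (h h' : Val 0) :
    W.LeOn S S' ((W.restrict S S').addHandler x y h h') :=
  ⟨fun h ha hb => ⟨h, ha, hb⟩, fun h ha hb => .inl ⟨h, ha, hb⟩,
    fun h ha hb => .inl ⟨h, ha, hb⟩, fun h ha hb => .inl ⟨h, ha, hb⟩⟩

theorem World.Good.addSync (hW : W.Good p) {a b : Prompt} (ha : a ∉ S) (hb : b ∉ S')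
    (hp : p ∈ S') : ((W.restrict S S').addSync a b).Good p where
  sync_right := by
    rintro c d d' (⟨h, hc, hd⟩ | ⟨rfl, rfl⟩) (⟨h', hc', hd'⟩ | ⟨h₁, rfl⟩)
    · exact hW.sync_right h h'
    · exact absurd (h₁ ▸ hc) ha
    · exact absurd hc' ha
    · rfl
  sync_left := by
    rintro c c' d (⟨h, hc, hd⟩ | ⟨rfl, rfl⟩) (⟨h', hc', hd'⟩ | ⟨rfl, h₁⟩)
    · exact hW.sync_left h h'
    · exact absurd (h₁ ▸ hd) hb
    · exact absurd hd' hb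
    · rfl
  sync_ne := by
    rintro c d (⟨h, -⟩ | ⟨rfl, rfl⟩)
    · exact hW.sync_ne h
    · rintro rfl
      exact hb hp
  handlers_right h h' := hW.handlers_right h.1 h'.1
  handlers_left h h' := hW.handlers_left h.1 h'.1
  disjoint := by
    rintro c d x y (⟨h, -⟩ | ⟨rfl, rfl⟩) hx
    · exact hW.disjoint h hx.1
    · rintro rfl
      exact ha hx.2.1
  compatible h h' := (hW.compatible h.1 h'.1).transport (World.leOn_addSync a b) h.2.2 h'.2.2

theorem World.Good.addHandler (hW : W.Good p) {a b : Prompt} {k k' : Val 0} (ha : a ∉ S)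
    (hb : b ∉ S') (hk : ValRel p W k k') (hkS : k.prompts ⊆ S) (hkS' : k'.prompts ⊆ S') :
    ((W.restrict S S').addHandler a b k k').Good p where
  sync_right h h' := hW.sync_right h.1 h'.1
  sync_left h h' := hW.sync_left h.1 h'.1
  sync_ne h := hW.sync_ne h.1
  handlers_right := by
    rintro c d d' (⟨h, hc, hd⟩ | ⟨rfl, rfl⟩) (⟨h', hc', hd'⟩ | ⟨h₁, rfl⟩)
    · exact hW.handlers_right h h'
    · exact absurd (h₁ ▸ hc) ha
    · exact absurd hc' ha
    · rfl
  handlers_left := by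
    rintro c c' d (⟨h, hc, hd⟩ | ⟨rfl, rfl⟩) (⟨h', hc', hd'⟩ | ⟨rfl, h₁⟩)
    · exact hW.handlers_left h h'
    · exact absurd (h₁ ▸ hd) hb
    · exact absurd hd' hb
    · rfl
  disjoint := by
    rintro c d x y h (⟨h', -⟩ | ⟨rfl, rfl⟩)
    · exact hW.disjoint h.1 h'
    · rintro rfl
      exact ha h.2.1
  compatible := by
    rintro c h h' (⟨h₁, hc, hh⟩ | ⟨rfl, rfl⟩) (⟨h₁', hc', hh'⟩ | ⟨h₂, rfl⟩)
    · exact (hW.compatible h₁ h₁').transport (World.leOn_addHandler ..) hh hh'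
    · exact absurd (h₂ ▸ hc) ha
    · exact absurd hc' ha
    · exact hk.transport (World.leOn_addHandler ..) hkS hkS'

theorem envPrompts_cons (v : Val 0) (Γ : List (Val 0)) :
    envPrompts (v :: Γ) = v.prompts ∪ envPrompts Γ := rfl

theorem envPrompts_append (Γ Δ : List (Val 0)) :
    envPrompts (Γ ++ Δ) = envPrompts Γ ∪ envPrompts Δ := by
  induction Γ with
  | nil => simp [envPrompts]
  | cons v Γ ih => rw [List.cons_append, envPrompts_cons, envPrompts_cons, ih, Finset.union_assoc]

theorem EnvRel.transport {W' : World} (hW : W.LeOn S S' W') {Γ Γ' : List (Val 0)}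
    (h : EnvRel p W Γ Γ') (hS : envPrompts Γ ⊆ S) (hS' : envPrompts Γ' ⊆ S') :
    EnvRel p W' Γ Γ' := by
  induction h with
  | nil => exact .nil
  | cons h _ ih =>
    rw [envPrompts_cons, Finset.union_subset_iff] at hS hS'
    exact .cons (h.transport hW hS.1 hS'.1) (ih hS.2 hS'.2)

/-! ## Transitions of states -/

theorem State.of_eq_run (Γ : List (Val 0)) {e : Expr 0} (he : ¬ e.IsValue) :
    State.of Γ e = .run Γ e he := by
  cases e with
  | val v => exact absurd ⟨v, rfl⟩ he
  | _ => rfl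

theorem Step.of_tau {Γ : List (Val 0)} {e e₁ : Expr 0} (he : ¬ e.IsValue) (h : Red e e₁)
    (hf : (e₁.prompts \ e.prompts) ∩ envPrompts Γ = ∅) :
    Step (.of Γ e) .tau (.of Γ e₁) := by
  rw [State.of_eq_run Γ he]
  exact .tau Γ e e₁ he h hf

theorem Det.step {e e₁ : Expr 0} (h : Det e e₁) (Γ : List (Val 0)) :
    Step (.of Γ e) .tau (.of Γ e₁) :=
  .of_tau h.not_isValue h.red
    (by rw [Finset.sdiff_eq_empty_iff_subset.2 h.prompts_subset, Finset.empty_inter])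

theorem Dets.weakTau {e e₁ : Expr 0} (h : Dets e e₁) (Γ : List (Val 0)) :
    WeakTau (.of Γ e) (.of Γ e₁) :=
  Relation.ReflTransGen.lift (State.of Γ) (fun _ _ h' => Det.step h' Γ) _ _ h

theorem grab_not_isValue (E : ECtx 0) (q : Prompt) (b : Expr 1) :
    ¬ (E.plug (.grab (.prompt q) b)).IsValue :=
  fun ⟨v, hv⟩ => (PotRedex.grab _ _).plug_ne_val E v hv

theorem fresh_not_isValue (E : ECtx 0) (b : Expr 1) : ¬ (E.plug (.fresh b)).IsValue :=
  fun ⟨v, hv⟩ => (PotRedex.fresh _).plug_ne_val E v hv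

theorem Step.of_stuck {Γ : List (Val 0)} {E E₀ : ECtx 0} {q : Prompt} {b : Expr 1}
    (hq : q ∉ E.surrounding) {F : MECtx 0} (hF : F.fill Γ = some E₀) {e₁ : Expr 0}
    (h : RedOrNormal (E₀.plug (E.plug (.grab (.prompt q) b))) e₁) :
    Step (.of Γ (E.plug (.grab (.prompt q) b))) (.stuck F) (.of Γ e₁) := by
  rw [State.of_eq_run Γ (grab_not_isValue E q b)]
  exact .stuck Γ E q b _ hq F E₀ hF e₁ h

/-- The transitions of a state whose last component is not a value. -/
theorem Step.of_inv {Γ : List (Val 0)} {e : Expr 0} (he : ¬ e.IsValue) {a : Label} {s : State}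
    (h : Step (.of Γ e) a s) :
    (a = .tau ∧ ∃ e₁, s = .of Γ e₁ ∧ Red e e₁ ∧
      (e₁.prompts \ e.prompts) ∩ envPrompts Γ = ∅) ∨
    ∃ (F : MECtx 0) (E : ECtx 0) (q : Prompt) (b : Expr 1) (E₀ : ECtx 0) (e₁ : Expr 0),
      a = .stuck F ∧ s = .of Γ e₁ ∧ e = E.plug (.grab (.prompt q) b) ∧
      q ∉ E.surrounding ∧ F.fill Γ = some E₀ ∧ RedOrNormal (E₀.plug e) e₁ := by
  rw [State.of_eq_run Γ he] at h
  cases h with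
  | tau _ _ e₁ _ h hf => exact .inl ⟨rfl, e₁, rfl, h, hf⟩
  | stuck _ E q b _ hq F E₀ hF e₁ h =>
    exact .inr ⟨F, E, q, b, E₀, e₁, rfl, rfl, rfl, hq, hF, h⟩

theorem Step.of_fresh {Γ : List (Val 0)} {E : ECtx 0} {b : Expr 1} {a : Prompt}
    (ha : a ∉ envPrompts Γ ∪ (E.plug (.fresh b)).prompts) :
    Step (.of Γ (E.plug (.fresh b))) .tau (.of Γ (E.plug (b.inst (.prompt a)))) := by
  simp only [ECtx.prompts_plug, Expr.prompts, Finset.mem_union, not_or] at ha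
  refine .of_tau (fresh_not_isValue E b) (.fresh_plug ha.2.2 ha.2.1) ?_
  have := b.prompts_inst (.prompt a)
  simp only [Finset.eq_empty_iff_forall_notMem, ECtx.prompts_plug, Expr.prompts, Val.prompts]
    at this ⊢
  grind

/-- Prompt generation can be assumed to choose a prompt that does not occur in the state. -/
theorem Red.exists_fresh {Γ : List (Val 0)} {E : ECtx 0} {b : Expr 1} {e₁ : Expr 0}
    (h : Red (E.plug (.fresh b)) e₁)
    (hf : (e₁.prompts \ (E.plug (.fresh b)).prompts) ∩ envPrompts Γ = ∅) :
    ∃ a, a ∉ envPrompts Γ ∪ (E.plug (.fresh b)).prompts ∧ e₁ = E.plug (b.inst (.prompt a)) := by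
  rcases h.det_or_fresh with hd | ⟨E', b', a, he, rfl, ha, hE⟩
  · generalize he : E.plug (.fresh b) = e at hd
    cases hd with
    | contract E' hc =>
      obtain ⟨rfl, rfl⟩ := plug_unique (.fresh _) hc.potRedex he
      cases hc
    | capture E' q E₂ b' hq =>
      obtain ⟨rfl, hr⟩ := plug_unique (.fresh _) (.grab _ _) he
      cases hr
  · obtain ⟨rfl, hr⟩ := plug_unique (.fresh _) (.fresh _) he
    cases hr
    by_cases haS : a ∈ envPrompts Γ ∪ (E.plug (.fresh b)).prompts
    · obtain ⟨c, hc⟩ := Infinite.exists_notMem_finset (envPrompts Γ ∪ (E.plug (.fresh b)).prompts)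
      refine ⟨c, hc, ?_⟩
      rw [Expr.inst_prompt_eq (fun hab => ?_) c]
      simp only [Finset.eq_empty_iff_forall_notMem, Finset.mem_inter, Finset.mem_sdiff,
        ECtx.prompts_plug, Expr.prompts, Finset.mem_union] at hf hE haS
      have h₁ := hf a
      have h₂ := hE a
      tauto
    · exact ⟨a, haS, rfl⟩

/-! ## The bisimulation -/

/-- Corresponding states. -/
inductive Sim (p : Prompt) : State → State → Prop
  | vals {W : World} {Γ Γ' : List (Val 0)} (hW : W.Good p) (hΓ : EnvRel p W Γ Γ')
      (hp : p ∈ envPrompts Γ') : Sim p (.vals Γ) (.vals Γ')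
  | expr {W : World} {Γ Γ' : List (Val 0)} {e e' e₂' : Expr 0} (hW : W.Good p)
      (hΓ : EnvRel p W Γ Γ') (hp : p ∈ envPrompts Γ') (hd : Dets e' e₂')
      (hc : Core p W e e₂') : Sim p (.of Γ e) (.of Γ' e')

theorem optionRel_some_left {α β : Type} {r : α → β → Prop} {a : Option α} {b : Option β} {x : α}
    (h : Option.Rel r a b) (ha : a = some x) : ∃ y, b = some y ∧ r x y := by
  subst ha
  cases h with
  | some h => exact ⟨_, rfl, h⟩

theorem optionRel_some_right {α β : Type} {r : α → β → Prop} {a : Option α} {b : Option β} {y : β}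
    (h : Option.Rel r a b) (hb : b = some y) : ∃ x, a = some x ∧ r x y := by
  subst hb
  cases h with
  | some h => exact ⟨_, rfl, h⟩

theorem ValRel.lam_left {e : Expr 1} {v' : Val 0} (h : ValRel p W (.lam e) v') :
    ∃ e', v' = .lam e' ∧ BodyRel p W e e' := by
  rcases h.shape with ⟨e, e', h₁, rfl, h⟩ | ⟨q, q', h₁, -⟩ | ⟨E, E', h₁, -⟩ <;> cases h₁
  exact ⟨_, rfl, h⟩

theorem ValRel.lam_right {v : Val 0} {e' : Expr 1} (h : ValRel p W v (.lam e')) :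
    ∃ e, v = .lam e ∧ BodyRel p W e e' := by
  rcases h.shape with ⟨e, e', rfl, h₁, h⟩ | ⟨q, q', rfl, h₁, -⟩ | ⟨E, E', rfl, h₁, -⟩ <;> cases h₁
  exact ⟨_, rfl, h⟩

theorem ValRel.prompt_left {q : Prompt} {v' : Val 0} (h : ValRel p W (.prompt q) v') :
    ∃ q', v' = .prompt q' ∧ W.sync q q' := by
  rcases h.shape with ⟨e, e', h₁, rfl, h⟩ | ⟨q, q', h₁, rfl, h⟩ | ⟨E, E', h₁, -⟩ <;> cases h₁
  exact ⟨_, rfl, h⟩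

theorem ValRel.prompt_right {v : Val 0} {q' : Prompt} (h : ValRel p W v (.prompt q')) :
    ∃ q, v = .prompt q ∧ W.sync q q' := by
  rcases h.shape with ⟨e, e', rfl, h₁, h⟩ | ⟨q, q', rfl, h₁, h⟩ | ⟨E, E', rfl, h₁, -⟩ <;> cases h₁
  exact ⟨_, rfl, h⟩

theorem ValRel.cont_left {E : ECtx 0} {v' : Val 0} (h : ValRel p W (.cont E) v') :
    ∃ E', v' = .cont E' ∧ CtxRel p W E E' := by
  rcases h.shape with ⟨e, e', h₁, rfl, h⟩ | ⟨q, q', h₁, -⟩ | ⟨E, E', h₁, rfl, h⟩ <;> cases h₁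
  exact ⟨_, rfl, h⟩

theorem ValRel.cont_right {v : Val 0} {E' : ECtx 0} (h : ValRel p W v (.cont E')) :
    ∃ E, v = .cont E ∧ CtxRel p W E E' := by
  rcases h.shape with ⟨e, e', rfl, h₁, h⟩ | ⟨q, q', rfl, h₁, -⟩ | ⟨E, E', rfl, h₁, h⟩ <;> cases h₁
  exact ⟨_, rfl, h⟩

theorem EnvRel.append {Γ Γ' Δ Δ' : List (Val 0)} (h : EnvRel p W Γ Γ') (h' : EnvRel p W Δ Δ') :
    EnvRel p W (Γ ++ Δ) (Γ' ++ Δ') :=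
  List.rel_append h h'

theorem Sim.append {Γ Γ' Δ Δ' : List (Val 0)} (hW : W.Good p) (hΓ : EnvRel p W Γ Γ')
    (hp : p ∈ envPrompts Γ') (h : EnvRel p W Δ Δ') : Sim p (.vals (Γ ++ Δ)) (.vals (Γ' ++ Δ')) :=
  .vals hW (hΓ.append h) (by rw [envPrompts_append]; exact Finset.mem_union_left _ hp)

theorem Sim.rel {Γ Γ' : List (Val 0)} {e e' : Expr 0} (hW : W.Good p) (hΓ : EnvRel p W Γ Γ')
    (hp : p ∈ envPrompts Γ') (h : ExprRel p W e e') : Sim p (.of Γ e) (.of Γ' e') :=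
  .expr hW hΓ hp .refl (.rel h)

theorem Sim.newPrompt {Γ Γ' : List (Val 0)} (hW : W.Good p) (hΓ : EnvRel p W Γ Γ')
    (hp : p ∈ envPrompts Γ') {a b : Prompt} (ha : a ∉ envPrompts Γ) (hb : b ∉ envPrompts Γ') :
    Sim p (.vals (Γ ++ [.prompt a])) (.vals (Γ' ++ [.prompt b])) :=
  .append (hW.addSync ha hb hp) (hΓ.transport (World.leOn_addSync a b) subset_rfl subset_rfl) hp
    (.cons (.prompt (.inr ⟨rfl, rfl⟩)) .nil)

theorem Sim.vals_forward {Γ Γ' : List (Val 0)} (hW : W.Good p) (hΓ : EnvRel p W Γ Γ')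
    (hp : p ∈ envPrompts Γ') {a : Label} {s : State} (h : Step (.vals Γ) a s) :
    a ≠ .tau ∧ ∃ t, Step (.vals Γ') a t ∧ Sim p s t := by
  cases h with
  | lam _ i e V v hi hV =>
    obtain ⟨v', hi', hv⟩ := optionRel_some_left (hΓ.getElem? i) hi
    obtain ⟨e', rfl, he⟩ := hv.lam_left
    obtain ⟨w, hV', hw⟩ := optionRel_some_left (hΓ.fillVal V) hV
    obtain ⟨e₂', hd, hc⟩ := he _ _ hw
    exact ⟨by simp, _, .lam Γ' i e' V w hi' hV', .expr hW hΓ hp hd hc⟩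
  | val => exact ⟨by simp, _, .val Γ', .vals hW hΓ hp⟩
  | ctx _ i E V v hi hV =>
    obtain ⟨v', hi', hv⟩ := optionRel_some_left (hΓ.getElem? i) hi
    obtain ⟨E', rfl, hE⟩ := hv.cont_left
    obtain ⟨w, hV', hw⟩ := optionRel_some_left (hΓ.fillVal V) hV
    exact ⟨by simp, _, .ctx Γ' i E' V w hi' hV', .rel hW hΓ hp (hE.plug (.val hw))⟩
  | eqPrompt _ i j q hi hj =>
    obtain ⟨v', hi', hv⟩ := optionRel_some_left (hΓ.getElem? i) hi
    obtain ⟨w', hj', hw⟩ := optionRel_some_left (hΓ.getElem? j) hj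
    obtain ⟨q', rfl, hq⟩ := hv.prompt_left
    obtain ⟨q'', rfl, hq'⟩ := hw.prompt_left
    obtain rfl := hW.sync_right hq hq'
    exact ⟨by simp, _, .eqPrompt Γ' i j q' hi' hj', .vals hW hΓ hp⟩
  | newPrompt _ a ha =>
    obtain ⟨b, hb⟩ := Infinite.exists_notMem_finset (envPrompts Γ')
    exact ⟨by simp, _, .newPrompt Γ' b hb, .newPrompt hW hΓ hp ha hb⟩
  | decomp _ i j E₁ E₂ q hi hj hq =>
    obtain ⟨v', hi', hv⟩ := optionRel_some_left (hΓ.getElem? i) hi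
    obtain ⟨w', hj', hw⟩ := optionRel_some_left (hΓ.getElem? j) hj
    obtain ⟨E', rfl, hE⟩ := hv.cont_left
    obtain ⟨q', rfl, hq'⟩ := hw.prompt_left
    obtain ⟨E₁', E₂', rfl, h₁, h₂⟩ := hE.split_left hW hq'
    exact ⟨by simp, _, .decomp Γ' i j E₁' E₂' q' hi' hj' ((h₂.mem_surrounding hW hq').not.1 hq),
      .append hW hΓ hp (.cons (.cont h₁) (.cons (.cont h₂) .nil))⟩

theorem Sim.vals_backward {Γ Γ' : List (Val 0)} (hW : W.Good p) (hΓ : EnvRel p W Γ Γ')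
    (hp : p ∈ envPrompts Γ') {a : Label} {t : State} (h : Step (.vals Γ') a t) :
    a ≠ .tau ∧ ∃ s, Step (.vals Γ) a s ∧ Sim p s t := by
  cases h with
  | lam _ i e' V v hi hV =>
    obtain ⟨v', hi', hv⟩ := optionRel_some_right (hΓ.getElem? i) hi
    obtain ⟨e, rfl, he⟩ := hv.lam_right
    obtain ⟨w, hV', hw⟩ := optionRel_some_right (hΓ.fillVal V) hV
    obtain ⟨e₂', hd, hc⟩ := he _ _ hw
    exact ⟨by simp, _, .lam Γ i e V w hi' hV', .expr hW hΓ hp hd hc⟩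
  | val => exact ⟨by simp, _, .val Γ, .vals hW hΓ hp⟩
  | ctx _ i E' V v hi hV =>
    obtain ⟨v', hi', hv⟩ := optionRel_some_right (hΓ.getElem? i) hi
    obtain ⟨E, rfl, hE⟩ := hv.cont_right
    obtain ⟨w, hV', hw⟩ := optionRel_some_right (hΓ.fillVal V) hV
    exact ⟨by simp, _, .ctx Γ i E V w hi' hV', .rel hW hΓ hp (hE.plug (.val hw))⟩
  | eqPrompt _ i j q' hi hj =>
    obtain ⟨v', hi', hv⟩ := optionRel_some_right (hΓ.getElem? i) hi
    obtain ⟨w', hj', hw⟩ := optionRel_some_right (hΓ.getElem? j) hj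
    obtain ⟨q, rfl, hq⟩ := hv.prompt_right
    obtain ⟨q'', rfl, hq'⟩ := hw.prompt_right
    obtain rfl := hW.sync_left hq hq'
    exact ⟨by simp, _, .eqPrompt Γ i j q hi' hj', .vals hW hΓ hp⟩
  | newPrompt _ b hb =>
    obtain ⟨a, ha⟩ := Infinite.exists_notMem_finset (envPrompts Γ)
    exact ⟨by simp, _, .newPrompt Γ a ha, .newPrompt hW hΓ hp ha hb⟩
  | decomp _ i j E₁' E₂' q' hi hj hq =>
    obtain ⟨v', hi', hv⟩ := optionRel_some_right (hΓ.getElem? i) hi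
    obtain ⟨w', hj', hw⟩ := optionRel_some_right (hΓ.getElem? j) hj
    obtain ⟨E, rfl, hE⟩ := hv.cont_right
    obtain ⟨q, rfl, hq'⟩ := hw.prompt_right
    obtain ⟨E₁, E₂, rfl, h₁, h₂⟩ := hE.split_right hW hq' rfl
    exact ⟨by simp, _, .decomp Γ i j E₁ E₂ q hi' hj' ((h₂.mem_surrounding hW hq').not.2 hq),
      .append hW hΓ hp (.cons (.cont h₁) (.cons (.cont h₂) .nil))⟩

theorem Sim.fresh {Γ Γ' : List (Val 0)} (hW : W.Good p) (hΓ : EnvRel p W Γ Γ')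
    (hp : p ∈ envPrompts Γ') {E E' : ECtx 0} {b b' : Expr 1} (hE : CtxRel p W E E')
    (hb : ExprRel p W b b') {a c : Prompt} (ha : a ∉ envPrompts Γ ∪ (E.plug (.fresh b)).prompts)
    (hc : c ∉ envPrompts Γ' ∪ (E'.plug (.fresh b')).prompts) :
    Sim p (.of Γ (E.plug (b.inst (.prompt a)))) (.of Γ' (E'.plug (b'.inst (.prompt c)))) := by
  have hle := World.leOn_addSync (W := W) (S := envPrompts Γ ∪ (E.plug (.fresh b)).prompts)
    (S' := envPrompts Γ' ∪ (E'.plug (.fresh b')).prompts) a c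
  refine .rel (hW.addSync ha hc (Finset.mem_union_left _ hp))
    (hΓ.transport hle Finset.subset_union_left Finset.subset_union_left) hp
    ((hE.transport hle ?_ ?_).plug ((hb.transport hle ?_ ?_).inst (.prompt (.inr ⟨rfl, rfl⟩))))
  all_goals simp only [ECtx.prompts_plug, Expr.prompts]; grind

theorem Sim.body {Γ Γ' : List (Val 0)} (hW : W.Good p) (hΓ : EnvRel p W Γ Γ')
    (hp : p ∈ envPrompts Γ') {E E' : ECtx 0} {f f' h h' : Val 0} (hE : CtxRel p W E E')
    (hf : ValRel p W f f') (hh : ValRel p W h h') {a c : Prompt}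
    (ha : a ∉ envPrompts Γ ∪ (E.plug (bodyL f h)).prompts)
    (hc : c ∉ envPrompts Γ' ∪ (E'.plug (bodyR p f' h')).prompts) :
    Sim p (.of Γ (E.plug (.reset (.prompt a) (.app (.val f) (.val (raiseL a h))))))
      (.of Γ' (E'.plug (handlerR p c h' (.app (.val f') (.val (raiseR p c)))))) := by
  have hle := World.leOn_addHandler (W := W) (S := envPrompts Γ ∪ (E.plug (bodyL f h)).prompts)
    (S' := envPrompts Γ' ∪ (E'.plug (bodyR p f' h')).prompts) a c h h'
  have hS : f.prompts ∪ h.prompts ⊆ (bodyL f h).prompts := (prompts_bodyL f h).ge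
  have hS' := subset_prompts_bodyR (p := p) f' h'
  have hg := hW.addHandler ha hc hh (by simp only [ECtx.prompts_plug]; grind)
    (by simp only [ECtx.prompts_plug]; grind)
  refine .rel hg
    (hΓ.transport hle Finset.subset_union_left Finset.subset_union_left) hp
    ((hE.transport hle ?_ ?_).plug (.handler (.inr ⟨rfl, rfl⟩) (.inr ⟨rfl, rfl⟩)
      (.app (.val (hf.transport hle ?_ ?_)) (.val (.raise (.inr ⟨rfl, rfl⟩) (.inr ⟨rfl, rfl⟩)
        (Val.clo_zero _).symm (Val.clo_zero _).symm)))))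
  all_goals simp only [ECtx.prompts_plug]; grind

/-- Prompt generation aside, two expressions go on with deterministic reductions, or not at all. -/
theorem Outcome.det_or_normal {f f' : Expr 0} (h : Outcome p W f f')
    (hf : ∀ (E : ECtx 0) (b : Expr 1), f ≠ E.plug (.fresh b)) :
    ((∀ f₁, ¬ Red f f₁) ∧ ∀ f₁, ¬ Red f' f₁) ∨
      ∃ f₁ f₁' f₂', Det f f₁ ∧ Det f' f₁' ∧ Dets f₁' f₂' ∧ Core p W f₁ f₂' := by
  cases h with
  | value =>
    refine .inl ⟨fun f₁ h => ?_, fun f₁ h => ?_⟩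
    all_goals
      rcases h.det_or_fresh with h | ⟨E, b, a, he, -⟩
      · exact h.not_isValue ⟨_, rfl⟩
      · exact fresh_not_isValue E b ⟨_, he.symm⟩
  | dead he he' => exact .inl ⟨he.not_red, he'.not_red⟩
  | stuck hq hq' => exact .inl ⟨not_red_of_stuck hq, not_red_of_stuck hq'⟩
  | det h h' h₁ h₂ => exact .inr ⟨_, _, _, h, h', h₁, h₂⟩
  | fresh => exact absurd rfl (hf _ _)
  | body => exact absurd rfl (hf _ _)

theorem RedOrNormal.of_normal {e e₁ : Expr 0} (h : ∀ e₁, ¬ Red e e₁) :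
    RedOrNormal e e₁ ↔ e₁ = e :=
  ⟨fun h' => (h'.resolve_left (h _)).2, fun h' => .inr ⟨h, h'⟩⟩

theorem Det.redOrNormal {e e₁ e₂ : Expr 0} (h : Det e e₁) : RedOrNormal e e₂ ↔ e₂ = e₁ :=
  ⟨fun h' => h'.elim h.eq_of_red fun h' => absurd h.red (h'.1 _), fun h' => h' ▸ .inl h.red⟩

/-- Testing corresponding expressions yields corresponding expressions. -/
theorem Core.redOrNormal (hW : W.Good p) {f f' : Expr 0} (h : Core p W f f')
    (hf : ∀ (E : ECtx 0) (b : Expr 1), f ≠ E.plug (.fresh b)) :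
    ∃ f₁ f₁' f₂', (∀ g, RedOrNormal f g ↔ g = f₁) ∧ (∀ g, RedOrNormal f' g ↔ g = f₁') ∧
      Dets f₁' f₂' ∧ Core p W f₁ f₂' := by
  obtain ⟨f₂', hd, hc, ho⟩ := h.outcome hW
  rcases ho.det_or_normal hf with ⟨hn, hn'⟩ | ⟨f₁, f₃', f₄', h₁, h₂, h₃, h₄⟩
  · refine ⟨f, ?_⟩
    rcases hd.cases_head with rfl | ⟨c, hc', hd⟩
    · exact ⟨_, _, fun _ => RedOrNormal.of_normal hn, fun _ => RedOrNormal.of_normal hn', .refl, hc⟩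
    · exact ⟨_, _, fun _ => RedOrNormal.of_normal hn, fun _ => hc'.redOrNormal, hd, hc⟩
  · refine ⟨f₁, ?_⟩
    rcases hd.cases_head with rfl | ⟨c, hc', hd⟩
    · exact ⟨_, _, fun _ => h₁.redOrNormal, fun _ => h₂.redOrNormal, h₃, h₄⟩
    · exact ⟨_, _, fun _ => h₁.redOrNormal, fun _ => hc'.redOrNormal, hd.trans (.head h₂ h₃), h₄⟩

theorem plug_grab_ne_fresh (E F : ECtx 0) (q : Prompt) (b c : Expr 1) :
    E.plug (.grab (.prompt q) b) ≠ F.plug (.fresh c) := fun h => by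
  cases (plug_unique (.grab _ _) (.fresh _) h).2

theorem Red.ne_stuck {e e₁ : Expr 0} (h : Red e e₁) {E : ECtx 0} {q : Prompt} {b : Expr 1}
    (hq : q ∉ E.surrounding) : e ≠ E.plug (.grab (.prompt q) b) := by
  rintro rfl
  exact not_red_of_stuck hq _ h

theorem weakStep_of_step {s t : State} {a : Label} (h : Step s a t) : WeakStep s a t := by
  by_cases ha : a = .tau
  · subst ha
    exact .inl ⟨rfl, .single h⟩
  · exact .inr ⟨ha, s, t, .refl, h, .refl⟩

theorem WeakTau.weakStep {s s' t : State} {a : Label} (h : WeakTau s s') (h' : WeakStep s' a t) :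
    WeakStep s a t := by
  rcases h' with ⟨rfl, h'⟩ | ⟨ha, s'', t', h₁, h₂, h₃⟩
  · exact .inl ⟨rfl, h.trans h'⟩
  · exact .inr ⟨ha, s'', t', h.trans h₁, h₂, h₃⟩

theorem Sim.expr_forward {Γ Γ' : List (Val 0)} (hW : W.Good p) (hΓ : EnvRel p W Γ Γ')
    (hp : p ∈ envPrompts Γ') {e e' : Expr 0} (hc : Core p W e e') (ho : Outcome p W e e')
    {a : Label} {s : State} (h : Step (.of Γ e) a s) :
    ∃ t, WeakStep (.of Γ' e') a t ∧ Sim p s t := by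
  cases ho with
  | value hv =>
    obtain ⟨-, t, ht, hs⟩ := Sim.vals_forward hW (hΓ.append (.cons hv .nil))
      (by rw [envPrompts_append]; exact Finset.mem_union_left _ hp) h
    exact ⟨t, weakStep_of_step ht, hs⟩
  | dead he he' =>
    rcases h.of_inv he.not_isValue with ⟨-, e₁, -, hr, -⟩ | ⟨F, E, q, b, E₀, e₁, -, -, hg, -⟩
    · exact absurd hr (he.not_red _)
    · exact absurd hg (he.not_grab _ _ _)
  | stuck hq hq' =>
    rcases h.of_inv (grab_not_isValue _ _ _) with
      ⟨-, e₁, -, hr, -⟩ | ⟨F, E, q, b, E₀, e₁, rfl, rfl, hg, -, hF, hr⟩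
    · exact absurd hr (not_red_of_stuck hq _)
    · obtain ⟨E₀', hF', hE₀⟩ := optionRel_some_left (hΓ.fillCtx F) hF
      obtain ⟨f₁, f₁', f₂', h₁, h₁', hd, hc⟩ := (hc.plug hE₀).redOrNormal hW fun E b => by
        rw [← ECtx.plug_comp]
        exact plug_grab_ne_fresh _ _ _ _ _
      rw [h₁] at hr
      subst hr
      exact ⟨_, weakStep_of_step (.of_stuck hq' hF' ((h₁' _).2 rfl)), .expr hW hΓ hp hd hc⟩
  | det h₁ h₁' h₂ h₃ =>
    rcases h.of_inv h₁.not_isValue with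
      ⟨rfl, e₁, rfl, hr, -⟩ | ⟨F, E, q, b, E₀, e₁, -, -, hg, hq, -⟩
    · rw [h₁.eq_of_red hr]
      exact ⟨_, weakStep_of_step (h₁'.step Γ'), .expr hW hΓ hp h₂ h₃⟩
    · exact absurd hg (h₁.red.ne_stuck hq)
  | fresh hE hb =>
    rename_i E E' b b'
    rcases h.of_inv (fresh_not_isValue _ _) with
      ⟨rfl, e₁, rfl, hr, hf⟩ | ⟨F, E, q, b, E₀, e₁, -, -, hg, -⟩
    · obtain ⟨a, ha, rfl⟩ := hr.exists_fresh hf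
      obtain ⟨c, hc⟩ := Infinite.exists_notMem_finset
        (envPrompts Γ' ∪ (E'.plug (.fresh b')).prompts)
      exact ⟨_, weakStep_of_step (.of_fresh hc), .fresh hW hΓ hp hE hb ha hc⟩
    · exact absurd hg.symm (plug_grab_ne_fresh _ _ _ _ _)
  | body hE hf' hh =>
    rename_i E E' f f' k k'
    rcases h.of_inv (fresh_not_isValue _ _) with
      ⟨rfl, e₁, rfl, hr, hf⟩ | ⟨F, E, q, b, E₀, e₁, -, -, hg, -⟩
    · obtain ⟨a, ha, rfl⟩ := hr.exists_fresh hf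
      obtain ⟨c, hc⟩ := Infinite.exists_notMem_finset
        (envPrompts Γ' ∪ (E'.plug (bodyR p f' k')).prompts)
      refine ⟨_, weakStep_of_step (.of_fresh hc), ?_⟩
      rw [inst_bodyL, inst_bodyR]
      exact .body hW hΓ hp hE hf' hh ha hc
    · exact absurd hg.symm (plug_grab_ne_fresh _ _ _ _ _)

theorem Sim.expr_backward {Γ Γ' : List (Val 0)} (hW : W.Good p) (hΓ : EnvRel p W Γ Γ')
    (hp : p ∈ envPrompts Γ') {e e' : Expr 0} (hc : Core p W e e') (ho : Outcome p W e e')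
    {a : Label} {t : State} (h : Step (.of Γ' e') a t) :
    ∃ s, WeakStep (.of Γ e) a s ∧ Sim p s t := by
  cases ho with
  | value hv =>
    obtain ⟨-, s, hs, ht⟩ := Sim.vals_backward hW (hΓ.append (.cons hv .nil))
      (by rw [envPrompts_append]; exact Finset.mem_union_left _ hp) h
    exact ⟨s, weakStep_of_step hs, ht⟩
  | dead he he' =>
    rcases h.of_inv he'.not_isValue with ⟨-, e₁, -, hr, -⟩ | ⟨F, E, q, b, E₀, e₁, -, -, hg, -⟩
    · exact absurd hr (he'.not_red _)
    · exact absurd hg (he'.not_grab _ _ _)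
  | stuck hq hq' =>
    rcases h.of_inv (grab_not_isValue _ _ _) with
      ⟨-, e₁, -, hr, -⟩ | ⟨F, E, q, b, E₀', e₁, rfl, rfl, hg, -, hF, hr⟩
    · exact absurd hr (not_red_of_stuck hq' _)
    · obtain ⟨E₀, hF', hE₀⟩ := optionRel_some_right (hΓ.fillCtx F) hF
      obtain ⟨f₁, f₁', f₂', h₁, h₁', hd, hc⟩ := (hc.plug hE₀).redOrNormal hW fun E b => by
        rw [← ECtx.plug_comp]
        exact plug_grab_ne_fresh _ _ _ _ _
      rw [h₁'] at hr
      subst hr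
      exact ⟨_, weakStep_of_step (.of_stuck hq hF' ((h₁ _).2 rfl)), .expr hW hΓ hp hd hc⟩
  | det h₁ h₁' h₂ h₃ =>
    rcases h.of_inv h₁'.not_isValue with
      ⟨rfl, e₁, rfl, hr, -⟩ | ⟨F, E, q, b, E₀, e₁, -, -, hg, hq, -⟩
    · rw [h₁'.eq_of_red hr]
      exact ⟨_, weakStep_of_step (h₁.step Γ), .expr hW hΓ hp h₂ h₃⟩
    · exact absurd hg (h₁'.red.ne_stuck hq)
  | fresh hE hb =>
    rename_i E E' b b'
    rcases h.of_inv (fresh_not_isValue _ _) with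
      ⟨rfl, e₁, rfl, hr, hf⟩ | ⟨F, E, q, b, E₀, e₁, -, -, hg, -⟩
    · obtain ⟨c, hc, rfl⟩ := hr.exists_fresh hf
      obtain ⟨a, ha⟩ := Infinite.exists_notMem_finset
        (envPrompts Γ ∪ (E.plug (.fresh b)).prompts)
      exact ⟨_, weakStep_of_step (.of_fresh ha), .fresh hW hΓ hp hE hb ha hc⟩
    · exact absurd hg.symm (plug_grab_ne_fresh _ _ _ _ _)
  | body hE hf' hh =>
    rename_i E E' f f' k k'
    rcases h.of_inv (fresh_not_isValue _ _) with
      ⟨rfl, e₁, rfl, hr, hf⟩ | ⟨F, E, q, b, E₀, e₁, -, -, hg, -⟩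
    · obtain ⟨c, hc, rfl⟩ := hr.exists_fresh hf
      obtain ⟨a, ha⟩ := Infinite.exists_notMem_finset
        (envPrompts Γ ∪ (E.plug (bodyL f k)).prompts)
      refine ⟨_, weakStep_of_step (.of_fresh ha), ?_⟩
      rw [inst_bodyL, inst_bodyR]
      exact .body hW hΓ hp hE hf' hh ha hc
    · exact absurd hg.symm (plug_grab_ne_fresh _ _ _ _ _)

theorem Sim.forward {s t s' : State} {a : Label} (h : Sim p s t) (hs : Step s a s') :
    ∃ t', WeakStep t a t' ∧ Sim p s' t' := by
  cases h with
  | vals hW hΓ hp =>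
    obtain ⟨-, t, ht, h⟩ := Sim.vals_forward hW hΓ hp hs
    exact ⟨t, weakStep_of_step ht, h⟩
  | expr hW hΓ hp hd hc =>
    obtain ⟨e₂', hd', hc, ho⟩ := hc.outcome hW
    obtain ⟨t', ht', h⟩ := Sim.expr_forward hW hΓ hp hc ho hs
    exact ⟨t', (Dets.weakTau (hd.trans hd') _).weakStep ht', h⟩

theorem Sim.backward {s t t' : State} {a : Label} (h : Sim p s t) (ht : Step t a t') :
    ∃ s', WeakStep s a s' ∧ Sim p s' t' := by
  cases h with
  | vals hW hΓ hp =>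
    obtain ⟨-, s, hs, h⟩ := Sim.vals_backward hW hΓ hp ht
    exact ⟨s, weakStep_of_step hs, h⟩
  | expr hW hΓ hp hd hc =>
    obtain ⟨e₂', hd', hc, ho⟩ := hc.outcome hW
    rcases (hd.trans hd').cases_head with rfl | ⟨e₁', h₁, hd₁⟩
    · exact Sim.expr_backward hW hΓ hp hc ho ht
    · rcases ht.of_inv h₁.not_isValue with
        ⟨rfl, e₁, rfl, hr, -⟩ | ⟨F, E, q, b, E₀, e₁, -, -, hg, hq, -⟩
      · rw [h₁.eq_of_red hr]
        exact ⟨_, .inl ⟨rfl, .refl⟩, .expr hW hΓ hp hd₁ hc⟩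
      · exact absurd hg (h₁.red.ne_stuck hq)

theorem starBisimulation_sim (p : Prompt) : StarBisimulation (Sim p) :=
  ⟨fun _ _ h => h, fun _ _ h => h, fun _ _ h =>
    ⟨fun _ _ hs => ⟨fun _ => h.forward hs, fun _ => h.forward hs⟩,
      fun _ _ ht => ⟨fun _ => h.backward ht, fun _ => h.backward ht⟩⟩⟩

theorem sim_handle (p : Prompt) : Sim p (.vals [handle]) (.vals [handleP p]) := by
  refine .vals (W := ⟨fun _ _ => False, fun _ _ => False, fun _ _ => False, fun _ _ => False⟩)
    ?_ (.cons (.handle (Val.clo_zero _).symm (Val.clo_zero _).symm) .nil) ?_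
  · constructor <;> simp
  · simp [envPrompts, handleP, Val.prompts, Expr.prompts]

end DelimControl

/-- The exception handler with a fresh prompt per handler is ⋆-bisimilar to the one with a single
prompt `p`, fresh names and iterative aborting. -/
theorem mainTheorem10 (p : DelimControl.Prompt) :
    DelimControl.StarBisimilar
      (DelimControl.State.of [] (.val DelimControl.handle))
      (DelimControl.State.of [] (.val (DelimControl.handleP p))) :=
  ⟨DelimControl.Sim p, DelimControl.starBisimulation_sim p, DelimControl.sim_handle p⟩
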